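/- Let $\Gamma=\{\varphi_1,\dots,\varphi_N\}$ be a set of LTL$_f$ formulas with past operators (linear temporal logic on finite nonempty traces) over a set $\mathcal V$ of propositional variables. A set of formulas is satisfiable if one finite trace satisfies all of them at its first position; an unsatisfiable core of $\Gamma$ is an unsatisfiable subset of $\Gamma$, not necessarily minimal. Let $A=\{A_1,\dots,A_N\}$ be fresh activation variables, $\Psi=\bigwedge_i(A_i\to\varphi_i)$, and let $\Psi'=\neg\mathsf{end}\wedge\mathbf F\,\mathsf{end}\wedge\mathbf G(\mathsf{end}\to\mathbf X\,\mathsf{end})\wedge \mathrm{f2l}(\Psi)$ with a fresh variable $\mathsf{end}$, where the map $\mathrm{f2l}$ into LTL over infinite traces commutes with variables, Boolean connectives and past operators and sends $\mathbf X\varphi$, $\mathbf F\varphi$, $\varphi_1\mathbf U\varphi_2$ to $\mathbf X(\mathrm{f2l}(\varphi)\wedge\neg\mathsf{end})$, $\mathbf F(\mathrm{f2l}(\varphi)\wedge\neg\mathsf{end})$, $\mathrm{f2l}(\varphi_1)\,\mathbf U\,(\mathrm{f2l}(\varphi_2)\wedge\neg\mathsf{end})$, and weak next, $\mathbf G\varphi$,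 $\varphi_1\mathbf R\varphi_2$ to $\mathbf X(\mathrm{f2l}(\varphi)\vee\mathsf{end})$, $\mathbf G(\mathrm{f2l}(\varphi)\vee\mathsf{end})$, $\mathrm{f2l}(\varphi_1)\,\mathbf R\,(\mathrm{f2l}(\varphi_2)\vee\mathsf{end})$. For an LTL formula $\phi$ of past-nesting depth $\delta$ and $k\ge 0$, consider the linear-size propositional bounded model checking encoding with virtual unrolling, over the universal model (all states initial, all transitions allowed). Its variables give the state and the truth values $|[\psi]|^d_i$ of all subformulas $\psi$ of $\phi$ at the times $i=0,\dots,k$ (and $k+1$) in the unrollings $d=0,\dots,\delta$ of the loop, the value of each $\psi$ at the last time in each unrolling, the start of the loop ($l$, at most one time in $0,\dots,k$), the times in the loop, and, for each subformula $\psi_1\mathbf U\psi_2$, a flag telling whether $\psi_2$ has already been true in the loop in unrolling $\delta$. * $\mathrm{Path}(\phi,k)$ says that $\phi$ is true at time $0$ and that all these values obey the one-step laws of the connectives and temporal operators at the times $0,\dots,k$ (for $d\ge 1$ only at the times in the loop; there the predecessor of the loop start is the last time of unrolling $d-1$), the values at time $k+1$ and the last-time values being left open. * $\mathrm{EncP}(\phi,k)$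 says in addition that a loop exists, that the last-time values are those at time $k$, that the values at time $k+1$ in unrolling $d$ are those at the loop start in unrolling $\min(d+1,\delta)$, and that every until true at time $k$ in unrolling $\delta$ has its flag set at time $k$. * $\mathrm{Simple}(\phi,k)$ says that the extended states at the times $0,\dots,k$ are pairwise distinct. An extended state consists of the membership in the loop, the values $|[\psi]|^0_i$ and, inside the loop, also the values $|[\psi]|^d_i$ with $d\ge 1$ and the flags. * $\mathrm{EncC}(\phi,k)=(\mathrm{Path}(\phi,k)\wedge\mathrm{Simple}(\phi,k))\vee\bigvee_{j<k}\mathrm{EncP}(\phi,j)$. The algorithm runs through $k=0,1,2,\dots$ as follows. If $\mathrm{EncC}(\Psi',k)$ is unsatisfiable under the assumptions that all $A_i\in A$ are true at time $0$, it returns a set $\mathrm{UC}\subseteq A$ supplied by the SAT solver, which may be any set of assumptions under which $\mathrm{EncC}(\Psi',k)$ is still unsatisfiable. Otherwise, if $\mathrm{EncP}(\Psi',k)$ is satisfiable with all $A_i\in A$ true at time $0$, it returns $\emptyset$. Otherwise it continues with $k+1$. **Theorem.** Every execution of the algorithm terminates and returns a result. If $\Gamma$ is satisfiable, the result is $\emptyset$.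 If $\Gamma$ is unsatisfiable, the result is a set $\mathrm{UC}\subseteq A$ with $\mathrm{UC}\neq\emptyset$ such that $\Phi_{\mathrm{UC}}=\{\varphi_i\mid A_i\in\mathrm{UC}\}$ is an unsatisfiable core of $\Gamma$. -/

import Mathlib

/-- Formulas of linear temporal logic on finite traces with past operators, over the variables `V`:
next `X`, weak next `N`, eventually `F`, globally `G`, until `U`, release `R`,
yesterday `Y`, weak yesterday `Z`, once `O`, historically `H`, since `S`, trigger `T`. -/
inductive LTLf (V : Type*) where
  | tru : LTLf V
  | atom : V → LTLf V
  | neg : LTLf V → LTLf V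
  | and : LTLf V → LTLf V → LTLf V
  | or : LTLf V → LTLf V → LTLf V
  | X : LTLf V → LTLf V
  | N : LTLf V → LTLf V
  | F : LTLf V → LTLf V
  | G : LTLf V → LTLf V
  | U : LTLf V → LTLf V → LTLf V
  | R : LTLf V → LTLf V → LTLf V
  | Y : LTLf V → LTLf V
  | Z : LTLf V → LTLf V
  | O : LTLf V → LTLf V
  | H : LTLf V → LTLf V
  | S : LTLf V → LTLf V → LTLf V
  | T : LTLf V → LTLf V → LTLf V

namespace LTLf

/-- `Holds π φ i`: the formula `φ` is true at position `i` of the finite, nonempty trace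
`π 0, …, π n`, whose states are the sets of variables that are true. -/
def Holds {V : Type*} {n : ℕ} (π : Fin (n + 1) → Set V) : LTLf V → Fin (n + 1) → Prop
  | tru, _ => True
  | atom x, i => x ∈ π i
  | neg φ, i => ¬ Holds π φ i
  | and φ ψ, i => Holds π φ i ∧ Holds π ψ i
  | or φ ψ, i => Holds π φ i ∨ Holds π ψ i
  | X φ, i => ∃ j : Fin (n + 1), (j : ℕ) = i + 1 ∧ Holds π φ j
  | N φ, i => ∀ j : Fin (n + 1), (j : ℕ) = i + 1 → Holds π φ j
  | F φ, i => ∃ j, i ≤ j ∧ Holds π φ j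
  | G φ, i => ∀ j, i ≤ j → Holds π φ j
  | U φ ψ, i => ∃ j, i ≤ j ∧ Holds π ψ j ∧ ∀ m, i ≤ m → m < j → Holds π φ m
  | R φ ψ, i => ∀ j, i ≤ j → Holds π ψ j ∨ ∃ m, i ≤ m ∧ m < j ∧ Holds π φ m
  | Y φ, i => ∃ j : Fin (n + 1), (j : ℕ) + 1 = i ∧ Holds π φ j
  | Z φ, i => ∀ j : Fin (n + 1), (j : ℕ) + 1 = i → Holds π φ j
  | O φ, i => ∃ j, j ≤ i ∧ Holds π φ j
  | H φ, i => ∀ j, j ≤ i → Holds π φ j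
  | S φ ψ, i => ∃ j, j ≤ i ∧ Holds π ψ j ∧ ∀ m, j < m → m ≤ i → Holds π φ m
  | T φ ψ, i => ∀ j, j ≤ i → Holds π ψ j ∨ ∃ m, j < m ∧ m ≤ i ∧ Holds π φ m

/-- A set of formulas is satisfiable if some finite trace satisfies all of them at its start. -/
def Satisfiable {V : Type*} (Γ : Set (LTLf V)) : Prop :=
  ∃ (n : ℕ) (π : Fin (n + 1) → Set V), ∀ φ ∈ Γ, Holds π φ 0

/-- An unsatisfiable core of `Γ` is an unsatisfiable subset of `Γ` (not necessarily minimal). -/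
def IsUnsatCore {V : Type*} (Γ Φ : Set (LTLf V)) : Prop :=
  Φ ⊆ Γ ∧ ¬ Satisfiable Φ

/-- Renaming of variables. -/
def rename {V W : Type*} (f : V → W) : LTLf V → LTLf W
  | tru => tru
  | atom x => atom (f x)
  | neg φ => neg (rename f φ)
  | and φ ψ => and (rename f φ) (rename f ψ)
  | or φ ψ => or (rename f φ) (rename f ψ)
  | X φ => X (rename f φ)
  | N φ => N (rename f φ)
  | F φ => F (rename f φ)
  | G φ => G (rename f φ)
  | U φ ψ => U (rename f φ) (rename f ψ)
  | R φ ψ => R (rename f φ) (rename f ψ)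
  | Y φ => Y (rename f φ)
  | Z φ => Z (rename f φ)
  | O φ => O (rename f φ)
  | H φ => H (rename f φ)
  | S φ ψ => S (rename f φ) (rename f ψ)
  | T φ ψ => T (rename f φ) (rename f ψ)

/-- The formula `⋀ i, (A i → φ i)` with fresh activation variables `A i = Sum.inr i`. -/
def activated {V : Type*} {n : ℕ} (φ : Fin n → LTLf V) : LTLf (V ⊕ Fin n) :=
  ((List.finRange n).map fun i =>
    or (neg (atom (Sum.inr i))) (rename Sum.inl (φ i))).foldr and tru

end LTLf

/-- Formulas of linear temporal logic with past on infinite traces; the remaining operators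
are the usual abbreviations below. -/
inductive LTL (P : Type*) where
  | tru : LTL P
  | atom : P → LTL P
  | neg : LTL P → LTL P
  | and : LTL P → LTL P → LTL P
  | X : LTL P → LTL P
  | U : LTL P → LTL P → LTL P
  | Y : LTL P → LTL P
  | S : LTL P → LTL P → LTL P

namespace LTL

variable {P : Type*}

def or (φ ψ : LTL P) : LTL P := neg (and (neg φ) (neg ψ))
def imp (φ ψ : LTL P) : LTL P := or (neg φ) ψ
def F (φ : LTL P) : LTL P := U tru φ
def G (φ : LTL P) : LTL P := neg (F (neg φ))
def R (φ ψ : LTL P) : LTL P := neg (U (neg φ) (neg ψ))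
def Z (φ : LTL P) : LTL P := neg (Y (neg φ))
def O (φ : LTL P) : LTL P := S tru φ
def H (φ : LTL P) : LTL P := neg (O (neg φ))
def T (φ ψ : LTL P) : LTL P := neg (S (neg φ) (neg ψ))

/-- The list of all subformulas. -/
def subs : LTL P → List (LTL P)
  | tru => [tru]
  | atom p => [atom p]
  | neg φ => neg φ :: subs φ
  | and φ ψ => and φ ψ :: (subs φ ++ subs ψ)
  | X φ => X φ :: subs φ
  | U φ ψ => U φ ψ :: (subs φ ++ subs ψ)
  | Y φ => Y φ :: subs φ
  | S φ ψ => S φ ψ :: (subs φ ++ subs ψ)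

/-- The maximal nesting depth of past operators. -/
def pastDepth : LTL P → ℕ
  | tru => 0
  | atom _ => 0
  | neg φ => pastDepth φ
  | and φ ψ => max (pastDepth φ) (pastDepth ψ)
  | X φ => pastDepth φ
  | U φ ψ => max (pastDepth φ) (pastDepth ψ)
  | Y φ => pastDepth φ + 1
  | S φ ψ => max (pastDepth φ) (pastDepth ψ) + 1

/-- The pairs `(ψ₁, ψ₂)` such that `ψ₁ U ψ₂` is a subformula. -/
def untils (φ : LTL P) : List (LTL P × LTL P) :=
  (subs φ).filterMap fun ψ => match ψ with
    | U ψ₁ ψ₂ => some (ψ₁, ψ₂)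
    | _ => none

end LTL

/-- The translation of finite-trace into infinite-trace formulas. The fresh variable `none` is
the marker "the finite trace has ended". -/
def LTLf.toLTL {W : Type*} : LTLf W → LTL (Option W)
  | tru => .tru
  | atom x => .atom (some x)
  | neg φ => .neg (toLTL φ)
  | and φ ψ => .and (toLTL φ) (toLTL ψ)
  | or φ ψ => .or (toLTL φ) (toLTL ψ)
  | X φ => .X (.and (toLTL φ) (.neg (.atom none)))
  | N φ => .X (.or (toLTL φ) (.atom none))
  | F φ => .F (.and (toLTL φ) (.neg (.atom none)))
  | G φ => .G (.or (toLTL φ) (.atom none))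
  | U φ ψ => .U (toLTL φ) (.and (toLTL ψ) (.neg (.atom none)))
  | R φ ψ => .R (toLTL φ) (.or (toLTL ψ) (.atom none))
  | Y φ => .Y (toLTL φ)
  | Z φ => .Z (toLTL φ)
  | O φ => .O (toLTL φ)
  | H φ => .H (toLTL φ)
  | S φ ψ => .S (toLTL φ) (toLTL ψ)
  | T φ ψ => .T (toLTL φ) (toLTL ψ)

/-- The formula `¬ end ∧ F end ∧ G (end → X end) ∧ toLTL φ`. -/
def LTLf.reduced {W : Type*} (φ : LTLf W) : LTL (Option W) :=
  .and (.neg (.atom none)) (.and (.F (.atom none))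
    (.and (.G (.imp (.atom none) (.X (.atom none)))) (toLTL φ)))

/-- Propositional formulas. -/
inductive PForm (α : Type*) where
  | tru : PForm α
  | fls : PForm α
  | var : α → PForm α
  | neg : PForm α → PForm α
  | and : PForm α → PForm α → PForm α
  | or : PForm α → PForm α → PForm α
  | imp : PForm α → PForm α → PForm α
  | iff : PForm α → PForm α → PForm α

namespace PForm

variable {α : Type*}

def Eval (v : α → Prop) : PForm α → Prop
  | tru => True
  | fls => False
  | var x => v x
  | neg φ => ¬ Eval v φ
  | and φ ψ => Eval v φ ∧ Eval v ψ
  | or φ ψ => Eval v φ ∨ Eval v ψ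
  | imp φ ψ => Eval v φ → Eval v ψ
  | iff φ ψ => (Eval v φ ↔ Eval v ψ)

/-- Conjunction of `f x` over the members `x` of a list. -/
def all {β : Type*} (l : List β) (f : β → PForm α) : PForm α :=
  (l.map f).foldr and tru

/-- Disjunction of `f x` over the members `x` of a list. -/
def any {β : Type*} (l : List β) (f : β → PForm α) : PForm α :=
  (l.map f).foldr or fls

/-- `φ` is satisfiable under the assumption that the variables in `L` are true. -/
def SatUnder (φ : PForm α) (L : Set α) : Prop :=
  ∃ v : α → Prop, Eval v φ ∧ ∀ x ∈ L, v x

end PForm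

/-- The variables of the bounded encodings. `state p i`: value of `p` at time `i`.
`sub ψ d i`: value of the subformula `ψ` at time `i` in the `d`-th virtual unrolling of the loop
(`d = 0` is the path itself). `subEnd ψ d`: value of `ψ` at the last time, in unrolling `d`.
`ev ψ i`: `ψ` occurred in the loop up to time `i`. `loop i`: the loop starts at time `i`.
`inLoop i`: time `i` belongs to the loop. -/
inductive BVar (P : Type*) where
  | state : P → ℕ → BVar P
  | sub : LTL P → ℕ → ℕ → BVar P
  | subEnd : LTL P → ℕ → BVar P
  | ev : LTL P → ℕ → BVar P
  | loop : ℕ → BVar P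
  | inLoop : ℕ → BVar P

/-! Bounded encoding over the universal model: every state is initial and every pair of states is
a transition, so initial condition, transition relation and closing of the loop are vacuous. -/
namespace BMC

variable {P : Type*}

abbrev state (p : P) (i : ℕ) : PForm (BVar P) := .var (.state p i)
abbrev sub (ψ : LTL P) (d i : ℕ) : PForm (BVar P) := .var (.sub ψ d i)
abbrev subEnd (ψ : LTL P) (d : ℕ) : PForm (BVar P) := .var (.subEnd ψ d)
abbrev ev (ψ : LTL P) (i : ℕ) : PForm (BVar P) := .var (.ev ψ i)
abbrev loop (i : ℕ) : PForm (BVar P) := .var (.loop i)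
abbrev inLoop (i : ℕ) : PForm (BVar P) := .var (.inLoop i)

/-- Value of `ψ` at the predecessor of time `i` in unrolling `d` (false at the very first time).
In an unrolling `d + 1`, the predecessor of the loop start is the last time of unrolling `d`. -/
def pred (ψ : LTL P) : ℕ → ℕ → PForm (BVar P)
  | 0, 0 => .fls
  | 0, i + 1 => sub ψ 0 i
  | d + 1, 0 => subEnd ψ d
  | d + 1, i + 1 =>
      .or (.and (loop (i + 1)) (subEnd ψ d)) (.and (.neg (loop (i + 1))) (sub ψ (d + 1) i))

/-- The constraint that fixes the value of `ψ` at time `i` in unrolling `d`. -/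
def step (d i : ℕ) : LTL P → PForm (BVar P)
  | .tru => sub .tru d i
  | .atom p => .iff (sub (.atom p) d i) (state p i)
  | .neg ψ => .iff (sub (.neg ψ) d i) (.neg (sub ψ d i))
  | .and ψ χ => .iff (sub (.and ψ χ) d i) (.and (sub ψ d i) (sub χ d i))
  | .X ψ => .iff (sub (.X ψ) d i) (sub ψ d (i + 1))
  | .U ψ χ => .iff (sub (.U ψ χ) d i)
      (.or (sub χ d i) (.and (sub ψ d i) (sub (.U ψ χ) d (i + 1))))
  | .Y ψ => .iff (sub (.Y ψ) d i) (pred ψ d i)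
  | .S ψ χ => .iff (sub (.S ψ χ) d i)
      (.or (sub χ d i) (.and (sub ψ d i) (pred (.S ψ χ) d i)))

/-- Values of all subformulas at the times `0, …, k`. The unrollings `d ≥ 1` concern only the
times in the loop. -/
def formulaConstraints (φ : LTL P) (k : ℕ) : PForm (BVar P) :=
  .all (List.range (k + 1)) fun i => .all φ.subs fun ψ =>
    .and (step 0 i ψ)
      (.all (List.range φ.pastDepth) fun d => .imp (inLoop i) (step (d + 1) i ψ))

/-- At most one of the times `0, …, k` is the start of the loop. -/
def loopConstraints (k : ℕ) : PForm (BVar P) :=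
  .and (.iff (inLoop 0) (loop 0))
    (.all (List.range k) fun i =>
      .and (.iff (inLoop (i + 1)) (.or (inLoop i) (loop (i + 1))))
        (.imp (inLoop i) (.neg (loop (i + 1)))))

/-- `ev χ i` says that `χ` is true, in the last unrolling, at some time `≤ i` in the loop,
for the right-hand sides `χ` of untils. -/
def eventConstraints (φ : LTL P) (k : ℕ) : PForm (BVar P) :=
  .all φ.untils fun u =>
    .and (.iff (ev u.2 0) (.and (inLoop 0) (sub u.2 φ.pastDepth 0)))
      (.all (List.range k) fun i => .iff (ev u.2 (i + 1))
        (.or (ev u.2 i) (.and (inLoop (i + 1)) (sub u.2 φ.pastDepth (i + 1)))))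

/-- A path of length `k`, along which `φ` has been evaluated, that starts with `φ` true; the values
`sub ψ d (k + 1)` and `subEnd ψ d` are left open. -/
def pathEnc (φ : LTL P) (k : ℕ) : PForm (BVar P) :=
  .and (sub φ 0 0)
    (.and (formulaConstraints φ k) (.and (loopConstraints k) (eventConstraints φ k)))

/-- The path of length `k` is closed to a lasso: there is a loop, the successor of time `k` in
unrolling `d` is the loop start in unrolling `d + 1` (in the last unrolling: in the same one), and
all untils are fulfilled. -/
def closeEnc (φ : LTL P) (k : ℕ) : PForm (BVar P) :=
  .and (inLoop k)
    (.and
      (.all φ.subs fun ψ => .all (List.range (φ.pastDepth + 1)) fun d =>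
        .and (.iff (subEnd ψ d) (sub ψ d k))
          (.all (List.range (k + 1)) fun i => .imp (loop i)
            (.iff (sub ψ d (k + 1)) (sub ψ (min (d + 1) φ.pastDepth) i))))
      (.all φ.untils fun u =>
        .imp (sub (.U u.1 u.2) φ.pastDepth k) (ev u.2 k)))

/-- The witness formula: some lasso `π[0,l-1] π[l,k]^ω` with `l ≤ k` satisfies `φ`. -/
def encP (φ : LTL P) (k : ℕ) : PForm (BVar P) :=
  .and (pathEnc φ k) (closeEnc φ k)

/-- The times `i` and `j` carry the same extended state. The unrollings `d ≥ 1` and the event flags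
count only inside the loop. -/
def sameState (φ : LTL P) (i j : ℕ) : PForm (BVar P) :=
  .and (.iff (inLoop i) (inLoop j))
    (.and (.all φ.subs fun ψ => .iff (sub ψ 0 i) (sub ψ 0 j))
      (.imp (inLoop i)
        (.and
          (.all φ.subs fun ψ => .all (List.range φ.pastDepth) fun d =>
            .iff (sub ψ (d + 1) i) (sub ψ (d + 1) j))
          (.all φ.untils fun u => .iff (ev u.2 i) (ev u.2 j)))))

/-- No extended state is visited twice at the times `0, …, k`. -/
def simplePath (φ : LTL P) (k : ℕ) : PForm (BVar P) :=
  .all (List.range (k + 1)) fun j => .all (List.range j) fun i => .neg (sameState φ i j)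

/-- The completeness formula: there is a path of length `k` through pairwise distinct extended
states, or already a witness of length less than `k`. -/
def encC (φ : LTL P) (k : ℕ) : PForm (BVar P) :=
  .or (.and (pathEnc φ k) (simplePath φ k)) (.any (List.range k) fun j => encP φ j)

end BMC

/-! The algorithm, as a transition system, for the formulas `φ 0, …, φ (n - 1)`. -/
namespace SatBMC

variable {V : Type*} {n : ℕ}

/-- The input formula `Ψ'`. -/
def input (φ : Fin n → LTLf V) : LTL (Option (V ⊕ Fin n)) :=
  (LTLf.activated φ).reduced

/-- The assumptions `A i` at time `0`, for `i` in `C`. -/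
def assumptions (V : Type*) {n : ℕ} (C : Finset (Fin n)) : Set (BVar (Option (V ⊕ Fin n))) :=
  {x | ∃ i ∈ C, x = .state (some (Sum.inr i)) 0}

/-- `running k`: at the head of the while loop with bound `k`. `returned UC`: halted with result
`UC`, a set of activation variables (given by their indices). -/
inductive Config (n : ℕ) where
  | running : ℕ → Config n
  | returned : Finset (Fin n) → Config n

/-- One iteration of the while loop. If the completeness formula is unsatisfiable under all
assumptions, the SAT solver may return any subset of them under which it is still unsatisfiable. -/
inductive Iter (φ : Fin n → LTLf V) : Config n → Config n → Prop
  | unsat (k : ℕ) (UC : Finset (Fin n))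
      (hC : ¬ (BMC.encC (input φ) k).SatUnder (assumptions V Finset.univ))
      (hUC : ¬ (BMC.encC (input φ) k).SatUnder (assumptions V UC)) :
      Iter φ (.running k) (.returned UC)
  | sat (k : ℕ)
      (hC : (BMC.encC (input φ) k).SatUnder (assumptions V Finset.univ))
      (hP : (BMC.encP (input φ) k).SatUnder (assumptions V Finset.univ)) :
      Iter φ (.running k) (.returned ∅)
  | next (k : ℕ)
      (hC : (BMC.encC (input φ) k).SatUnder (assumptions V Finset.univ))
      (hP : ¬ (BMC.encP (input φ) k).SatUnder (assumptions V Finset.univ)) :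
      Iter φ (.running k) (.running (k + 1))

/-- Some execution, started with bound `0`, reaches the configuration `c`. -/
def Reaches (φ : Fin n → LTLf V) (c : Config n) : Prop :=
  Relation.ReflTransGen (Iter φ) (.running 0) c

/-- Every execution halts with a result: none is infinite, and none gets stuck before it
returns. -/
def AlwaysReturns (φ : Fin n → LTLf V) : Prop :=
  (¬ ∃ c : ℕ → Config n, c 0 = .running 0 ∧ ∀ m, Iter φ (c m) (c (m + 1))) ∧
    ∀ k, Reaches φ (.running k) → ∃ c, Iter φ (.running k) c

end SatBMC

/-! For every set of activation variables, some witness formula is satisfiable under it iff the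
activated formulas have a common finite model (`exists_encP_satUnder_iff`). One direction unrolls a
lasso into an infinite trace: its labels obey the local laws, are eventually periodic and fulfil
untils, and such a labelling is truth (`label_iff_holds`, resting on `holds_add_period`). The other
direction needs only traces that stay in the state `{end}` from some time on. There every subformula
stabilises, so a loop of length one suffices (`exists_encP_of_holds`).

A shortest witness visits no extended state twice, since the part between two visits could be cut
out (`exists_encP_of_sameState`). Its prefixes are therefore simple paths, and one witness makes
every completeness formula satisfiable. Contrapositively, unsatisfiability of a completeness formula
under a set of assumptions refutes the corresponding formulas. The core is nonempty because the
empty set of formulas is satisfiable.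

Termination is a pigeonhole argument: for large `k` no simple path exists, so a satisfiable
completeness formula would contain a witness that an earlier iteration has already excluded. -/

namespace PForm

variable {α β : Type*} {v : α → Prop}

theorem eval_all {l : List β} {f : β → PForm α} :
    Eval v (all l f) ↔ ∀ x ∈ l, Eval v (f x) := by
  induction l with
  | nil => simp [all, Eval]
  | cons a l ih => simpa [all, Eval] using fun _ => ih

theorem eval_any {l : List β} {f : β → PForm α} :
    Eval v (any l f) ↔ ∃ x ∈ l, Eval v (f x) := by
  induction l with
  | nil => simp [any, Eval]
  | cons a l ih => simpa [any, Eval] using or_congr_right ih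

end PForm

/-! ### Semantics on infinite traces: expansion laws, periodicity, stabilisation. -/

namespace LTL

variable {P : Type*}

/-- Truth of a formula at a time of an infinite trace. -/
def Holds (σ : ℕ → Set P) : LTL P → ℕ → Prop
  | tru, _ => True
  | atom x, i => x ∈ σ i
  | neg φ, i => ¬ Holds σ φ i
  | and φ ψ, i => Holds σ φ i ∧ Holds σ ψ i
  | X φ, i => Holds σ φ (i + 1)
  | U φ ψ, i => ∃ j, i ≤ j ∧ Holds σ ψ j ∧ ∀ m, i ≤ m → m < j → Holds σ φ m
  | Y φ, i => ∃ j, j + 1 = i ∧ Holds σ φ j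
  | S φ ψ, i => ∃ j, j ≤ i ∧ Holds σ ψ j ∧ ∀ m, j < m → m ≤ i → Holds σ φ m

variable {σ : ℕ → Set P} {φ ψ χ : LTL P} {i : ℕ}

theorem holds_until_iff :
    Holds σ (U ψ χ) i ↔ Holds σ χ i ∨ Holds σ ψ i ∧ Holds σ (U ψ χ) (i + 1) := by
  constructor
  · rintro ⟨j, hij, hj, hm⟩
    rcases hij.eq_or_lt with rfl | hlt
    · exact .inl hj
    · exact .inr ⟨hm i le_rfl hlt, j, hlt, hj, fun m h1 h2 => hm m (by omega) h2⟩
  · rintro (h | ⟨h, j, hij, hj, hm⟩)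
    · exact ⟨i, le_rfl, h, fun m h1 h2 => by omega⟩
    · refine ⟨j, by omega, hj, fun m h1 h2 => ?_⟩
      rcases h1.eq_or_lt with rfl | hlt
      · exact h
      · exact hm m hlt h2

theorem holds_since_zero : Holds σ (S ψ χ) 0 ↔ Holds σ χ 0 := by
  constructor
  · rintro ⟨j, hj, h, -⟩
    rwa [Nat.le_zero.1 hj] at h
  · exact fun h => ⟨0, le_rfl, h, fun m h1 h2 => by omega⟩

theorem holds_since_succ :
    Holds σ (S ψ χ) (i + 1) ↔
      Holds σ χ (i + 1) ∨ Holds σ ψ (i + 1) ∧ Holds σ (S ψ χ) i := by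
  constructor
  · rintro ⟨j, hij, hj, hm⟩
    rcases hij.eq_or_lt with rfl | hlt
    · exact .inl hj
    · exact .inr ⟨hm _ hlt le_rfl, j, by omega, hj, fun m h1 h2 => hm m h1 (by omega)⟩
  · rintro (h | ⟨h, j, hij, hj, hm⟩)
    · exact ⟨i + 1, le_rfl, h, fun m h1 h2 => by omega⟩
    · refine ⟨j, by omega, hj, fun m h1 h2 => ?_⟩
      rcases h2.eq_or_lt with rfl | hlt
      · exact h
      · exact hm m h1 (by omega)

theorem holds_yesterday_zero : ¬ Holds σ (Y ψ) 0 := by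
  rintro ⟨j, h, -⟩
  omega

theorem holds_yesterday_succ : Holds σ (Y ψ) (i + 1) ↔ Holds σ ψ i := by
  constructor
  · rintro ⟨j, h, hj⟩
    rwa [← Nat.succ.inj h]
  · exact fun h => ⟨i, rfl, h⟩

theorem self_mem_subs (φ : LTL P) : φ ∈ subs φ := by
  cases φ <;> simp [subs]

theorem subs_subset_of_mem : ∀ {φ ψ : LTL P}, ψ ∈ subs φ → subs ψ ⊆ subs φ := by
  intro φ
  induction φ with
  | tru => intro ψ h; simp only [subs, List.mem_singleton] at h; subst h; simp [subs]
  | atom p => intro ψ h; simp only [subs, List.mem_singleton] at h; subst h; simp [subs]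
  | neg φ ih | X φ ih | Y φ ih =>
    intro ψ h
    rcases List.mem_cons.1 h with rfl | h
    · exact List.Subset.refl _
    · exact List.subset_cons_of_subset _ (ih h)
  | and φ φ' ih ih' | U φ φ' ih ih' | S φ φ' ih ih' =>
    intro ψ h
    rcases List.mem_cons.1 h with rfl | h
    · exact List.Subset.refl _
    · rcases List.mem_append.1 h with h | h
      · exact List.subset_cons_of_subset _ (List.subset_append_of_subset_left _ (ih h))
      · exact List.subset_cons_of_subset _ (List.subset_append_of_subset_right _ (ih' h))

theorem neg_arg_mem (h : neg ψ ∈ subs φ) : ψ ∈ subs φ :=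
  subs_subset_of_mem h (by simp [subs, self_mem_subs])

theorem and_left_mem (h : and ψ χ ∈ subs φ) : ψ ∈ subs φ :=
  subs_subset_of_mem h (by simp [subs, self_mem_subs])

theorem and_right_mem (h : and ψ χ ∈ subs φ) : χ ∈ subs φ :=
  subs_subset_of_mem h (by simp [subs, self_mem_subs])

theorem next_arg_mem (h : X ψ ∈ subs φ) : ψ ∈ subs φ :=
  subs_subset_of_mem h (by simp [subs, self_mem_subs])

theorem until_left_mem (h : U ψ χ ∈ subs φ) : ψ ∈ subs φ :=
  subs_subset_of_mem h (by simp [subs, self_mem_subs])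

theorem until_right_mem (h : U ψ χ ∈ subs φ) : χ ∈ subs φ :=
  subs_subset_of_mem h (by simp [subs, self_mem_subs])

theorem yesterday_arg_mem (h : Y ψ ∈ subs φ) : ψ ∈ subs φ :=
  subs_subset_of_mem h (by simp [subs, self_mem_subs])

theorem since_left_mem (h : S ψ χ ∈ subs φ) : ψ ∈ subs φ :=
  subs_subset_of_mem h (by simp [subs, self_mem_subs])

theorem since_right_mem (h : S ψ χ ∈ subs φ) : χ ∈ subs φ :=
  subs_subset_of_mem h (by simp [subs, self_mem_subs])

theorem mem_untils {u : LTL P × LTL P} : u ∈ untils φ ↔ U u.1 u.2 ∈ subs φ := by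
  obtain ⟨a, b⟩ := u
  simp only [untils, List.mem_filterMap]
  constructor
  · rintro ⟨ψ, hψ, h⟩
    cases ψ <;> simp at h
    obtain ⟨rfl, rfl⟩ := h
    exact hψ
  · exact fun h => ⟨_, h, rfl⟩

theorem pastDepth_le_of_mem : ∀ {φ ψ : LTL P}, ψ ∈ subs φ → pastDepth ψ ≤ pastDepth φ := by
  intro φ
  induction φ with
  | tru => intro ψ h; simp only [subs, List.mem_singleton] at h; subst h; simp
  | atom p => intro ψ h; simp only [subs, List.mem_singleton] at h; subst h; simp
  | neg φ ih | X φ ih | Y φ ih =>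
    intro ψ h
    rcases List.mem_cons.1 h with rfl | h
    · exact le_rfl
    · have := ih h; simp only [pastDepth]; omega
  | and φ φ' ih ih' | U φ φ' ih ih' | S φ φ' ih ih' =>
    intro ψ h
    rcases List.mem_cons.1 h with rfl | h
    · exact le_rfl
    · rcases List.mem_append.1 h with h | h
      · have := ih h; simp only [pastDepth]; omega
      · have := ih' h; simp only [pastDepth]; omega

/-- On a trace of period `p` from time `l` on, a formula of past-nesting depth `d` has a periodic
truth value from the `d`-th unrolling of the loop on. -/
theorem holds_add_period {l p : ℕ} (hp : 0 < p) (hσ : ∀ t, l ≤ t → σ (t + p) = σ t) :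
    ∀ (ψ : LTL P) (d : ℕ), pastDepth ψ ≤ d → ∀ t, l + d * p ≤ t →
      (Holds σ ψ (t + p) ↔ Holds σ ψ t) := by
  intro ψ
  induction ψ with
  | tru => intros; rfl
  | atom x =>
    intro d _ t ht
    simp only [Holds, hσ t (le_trans (Nat.le_add_right _ _) ht)]
  | neg ψ ih =>
    intro d hd t ht
    exact not_congr (ih d hd t ht)
  | and ψ χ ih ih' =>
    intro d hd t ht
    simp only [pastDepth] at hd
    exact and_congr (ih d (by omega) t ht) (ih' d (by omega) t ht)
  | X ψ ih =>
    intro d hd t ht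
    have := ih d hd (t + 1) (by omega)
    rwa [Nat.add_right_comm] at this
  | U ψ χ ih ih' =>
    intro d hd t ht
    simp only [pastDepth] at hd
    constructor
    · rintro ⟨j, hij, hj, hm⟩
      obtain ⟨j, rfl⟩ : ∃ j', j = j' + p := ⟨j - p, by omega⟩
      exact ⟨j, by omega, (ih' d (by omega) j (by omega)).1 hj, fun m h1 h2 =>
        (ih d (by omega) m (by omega)).1 (hm (m + p) (by omega) (by omega))⟩
    · rintro ⟨j, hij, hj, hm⟩
      refine ⟨j + p, by omega, (ih' d (by omega) j (by omega)).2 hj, fun m h1 h2 => ?_⟩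
      obtain ⟨m, rfl⟩ : ∃ m', m = m' + p := ⟨m - p, by omega⟩
      exact (ih d (by omega) m (by omega)).2 (hm m (by omega) (by omega))
  | Y ψ ih =>
    intro d hd t ht
    simp only [pastDepth] at hd
    -- The operator itself uses up one unrolling: `t` lies a full period beyond the bound for `ψ`,
    -- so `t - 1` still satisfies that bound.
    obtain ⟨d, rfl⟩ : ∃ d', d = d' + 1 := ⟨d - 1, by omega⟩
    rw [Nat.add_mul, one_mul] at ht
    obtain ⟨t, rfl⟩ : ∃ t', t = t' + 1 := ⟨t - 1, by omega⟩
    rw [Nat.add_right_comm, holds_yesterday_succ, holds_yesterday_succ]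
    exact ih d (by omega) t (by omega)
  | S ψ χ ih ih' =>
    intro d hd t ht
    simp only [pastDepth] at hd
    obtain ⟨d, rfl⟩ : ∃ d', d = d' + 1 := ⟨d - 1, by omega⟩
    rw [Nat.add_mul, one_mul] at ht
    replace ih := ih d (by omega)
    replace ih' := ih' d (by omega)
    obtain ⟨b, hb⟩ : ∃ b, b = l + d * p := ⟨_, rfl⟩
    rw [← hb] at ih ih'
    constructor
    · rintro ⟨j, hij, hj, hm⟩
      by_cases hjt : j ≤ t
      -- A witness up to `t` is kept. A later one lies in `(t, t + p]`, and shifting it back by `p`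
      -- stays above `b`.
      · exact ⟨j, hjt, hj, fun m h1 h2 => hm m h1 (by omega)⟩
      · obtain ⟨j, rfl⟩ : ∃ j', j = j' + p := ⟨j - p, by omega⟩
        exact ⟨j, by omega, (ih' j (by omega)).1 hj, fun m h1 h2 =>
          (ih m (by omega)).1 (hm (m + p) (by omega) (by omega))⟩
    · rintro ⟨j, hij, hj, hm⟩
      by_cases hjb : b ≤ j
      · refine ⟨j + p, by omega, (ih' j hjb).2 hj, fun m h1 h2 => ?_⟩
        obtain ⟨m, rfl⟩ : ∃ m', m = m' + p := ⟨m - p, by omega⟩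
        exact (ih m (by omega)).2 (hm m (by omega) (by omega))
      -- A witness before `b` is kept: the new times in `(t, t + p]` are shifts of times in `(t - p,
      -- t]`, which come after `j` because `b ≤ t - p`.
      · refine ⟨j, by omega, hj, fun m h1 h2 => ?_⟩
        by_cases hmt : m ≤ t
        · exact hm m h1 hmt
        · obtain ⟨m, rfl⟩ : ∃ m', m = m' + p := ⟨m - p, by omega⟩
          exact (ih m (by omega)).2 (hm m (by omega) (by omega))

/-- A labelling of the times by formulas that obeys the local laws of the connectives, is periodic
after `δ` unrollings of a loop and fulfills all untils, coincides with truth. The laws of the past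
operators are needed only until the end of unrolling `δ`. -/
theorem label_iff_holds {l p δ : ℕ} (hp : 0 < p) (hσ : ∀ t, l ≤ t → σ (t + p) = σ t)
    {w : ℕ → LTL P → Prop} (hδ : pastDepth φ ≤ δ)
    (hper : ∀ ψ ∈ subs φ, ∀ t, l + δ * p ≤ t → (w (t + p) ψ ↔ w t ψ))
    (htru : tru ∈ subs φ → ∀ t, w t tru)
    (hatom : ∀ x, atom x ∈ subs φ → ∀ t, w t (atom x) ↔ x ∈ σ t)
    (hneg : ∀ ψ, neg ψ ∈ subs φ → ∀ t, w t (neg ψ) ↔ ¬ w t ψ)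
    (hand : ∀ ψ χ, and ψ χ ∈ subs φ → ∀ t, w t (and ψ χ) ↔ w t ψ ∧ w t χ)
    (hX : ∀ ψ, X ψ ∈ subs φ → ∀ t, w t (X ψ) ↔ w (t + 1) ψ)
    (hU : ∀ ψ χ, U ψ χ ∈ subs φ → ∀ t, w t (U ψ χ) ↔ w t χ ∨ w t ψ ∧ w (t + 1) (U ψ χ))
    (hfair : ∀ ψ χ, U ψ χ ∈ subs φ → ∀ t, (∀ s, t ≤ s → w s (U ψ χ)) → ∃ s, t ≤ s ∧ w s χ)
    (hY0 : ∀ ψ, Y ψ ∈ subs φ → ¬ w 0 (Y ψ))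
    (hY : ∀ ψ, Y ψ ∈ subs φ → ∀ t, t + 1 < l + (δ + 1) * p → (w (t + 1) (Y ψ) ↔ w t ψ))
    (hS0 : ∀ ψ χ, S ψ χ ∈ subs φ → (w 0 (S ψ χ) ↔ w 0 χ))
    (hS : ∀ ψ χ, S ψ χ ∈ subs φ → ∀ t, t + 1 < l + (δ + 1) * p →
      (w (t + 1) (S ψ χ) ↔ w (t + 1) χ ∨ w (t + 1) ψ ∧ w t (S ψ χ))) :
    ∀ ψ ∈ subs φ, ∀ t, w t ψ ↔ Holds σ ψ t := by
  -- Labels and truth both have period `p` from `l + δ * p` on, so agreement through one more period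
  -- extends to all times. This is why the past laws are needed only up to there.
  have hext : ∀ ψ ∈ subs φ, (∀ t, t < l + (δ + 1) * p → (w t ψ ↔ Holds σ ψ t)) →
      ∀ t, w t ψ ↔ Holds σ ψ t := by
    intro ψ hψ h t
    induction t using Nat.strong_induction_on with
    | _ t ih =>
      by_cases ht : t < l + (δ + 1) * p
      · exact h t ht
      · rw [Nat.add_mul, one_mul] at ht
        obtain ⟨t, rfl⟩ : ∃ t', t = t' + p := ⟨t - p, by omega⟩
        have hb : l + δ * p ≤ t := by omega
        rw [hper ψ hψ t hb,
          holds_add_period hp hσ ψ δ ((pastDepth_le_of_mem hψ).trans hδ) t hb]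
        exact ih t (by omega)
  intro ψ
  induction ψ with
  | tru => intro h t; simp [Holds, htru h t]
  | atom x => intro h t; exact hatom x h t
  | neg ψ ih => intro h t; rw [hneg ψ h, ih (neg_arg_mem h)]; rfl
  | and ψ χ ih ih' =>
    intro h t; rw [hand ψ χ h, ih (and_left_mem h), ih' (and_right_mem h)]; rfl
  | X ψ ih => intro h t; rw [hX ψ h, ih (next_arg_mem h)]; rfl
  | U ψ χ ih ih' =>
    intro h t
    replace ih := ih (until_left_mem h)
    replace ih' := ih' (until_right_mem h)
    constructor
    · intro ht
      by_contra hn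
      -- The common expansion law propagates a disagreement forever, with `χ` always false; this
      -- contradicts fairness.
      have key : ∀ s, t ≤ s → w s (U ψ χ) ∧ ¬ Holds σ (U ψ χ) s := by
        intro s hs
        induction s, hs using Nat.le_induction with
        | base => exact ⟨ht, hn⟩
        | succ s hs ihs =>
          obtain ⟨h1, h2⟩ := ihs
          rw [hU ψ χ h s, ih, ih'] at h1
          rw [holds_until_iff] at h2
          tauto
      obtain ⟨s, hs, hχ⟩ := hfair ψ χ h t fun s hs => (key s hs).1
      exact (key s hs).2 (holds_until_iff.2 (.inl ((ih' s).1 hχ)))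
    · rintro ⟨j, htj, hj, hm⟩
      induction htj using Nat.decreasingInduction with
      | self => exact (hU ψ χ h _).2 (.inl ((ih' _).2 hj))
      | of_succ s hs ihs =>
        exact (hU ψ χ h s).2 (.inr ⟨(ih s).2 (hm s le_rfl hs),
          ihs fun m h1 h2 => hm m (by omega) h2⟩)
  | Y ψ ih =>
    intro h
    refine hext _ h fun t ht => ?_
    cases t with
    | zero => exact iff_of_false (hY0 ψ h) holds_yesterday_zero
    | succ t => rw [hY ψ h t ht, holds_yesterday_succ, ih (yesterday_arg_mem h)]
  | S ψ χ ih ih' =>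
    intro h
    refine hext _ h fun t ht => ?_
    induction t with
    | zero => rw [hS0 ψ χ h, holds_since_zero, ih' (since_right_mem h)]
    | succ t iht =>
      rw [hS ψ χ h t ht, holds_since_succ, ih (since_left_mem h), ih' (since_right_mem h),
        iht (by omega)]

/-- On an eventually constant trace every formula has an eventually constant truth value. -/
theorem holds_eventually_const {N : ℕ} (hσ : ∀ t, N ≤ t → σ t = σ N) (ψ : LTL P) :
    (∃ M, ∀ t, M ≤ t → Holds σ ψ t) ∨ (∃ M, ∀ t, M ≤ t → ¬ Holds σ ψ t) := by
  induction ψ with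
  | tru => exact .inl ⟨0, fun _ _ => trivial⟩
  | atom x =>
    by_cases hx : x ∈ σ N
    · exact .inl ⟨N, fun t ht => by simpa only [Holds, hσ t ht]⟩
    · exact .inr ⟨N, fun t ht => by simpa only [Holds, hσ t ht]⟩
  | neg ψ ih =>
    rcases ih with ⟨M, h⟩ | ⟨M, h⟩
    · exact .inr ⟨M, fun t ht => not_not_intro (h t ht)⟩
    · exact .inl ⟨M, h⟩
  | and ψ χ ih ih' =>
    rcases ih with ⟨M, h⟩ | ⟨M, h⟩
    · rcases ih' with ⟨M', h'⟩ | ⟨M', h'⟩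
      · exact .inl ⟨max M M', fun t ht => ⟨h t (by omega), h' t (by omega)⟩⟩
      · exact .inr ⟨M', fun t ht hc => h' t ht hc.2⟩
    · exact .inr ⟨M, fun t ht hc => h t ht hc.1⟩
  | X ψ ih =>
    rcases ih with ⟨M, h⟩ | ⟨M, h⟩
    · exact .inl ⟨M, fun t ht => h (t + 1) (by omega)⟩
    · exact .inr ⟨M, fun t ht => h (t + 1) (by omega)⟩
  | U ψ χ _ ih =>
    rcases ih with ⟨M, h⟩ | ⟨M, h⟩
    · exact .inl ⟨M, fun t ht => holds_until_iff.2 (.inl (h t ht))⟩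
    · exact .inr ⟨M, fun t ht ⟨j, h1, h2, _⟩ => h j (by omega) h2⟩
  | Y ψ ih =>
    rcases ih with ⟨M, h⟩ | ⟨M, h⟩
    · exact .inl ⟨M + 1, fun t ht => ⟨t - 1, by omega, h _ (by omega)⟩⟩
    · exact .inr ⟨M + 1, fun t ht ⟨j, h1, h2⟩ => h j (by omega) h2⟩
  | S ψ χ ih ih' =>
    rcases ih' with ⟨M, h⟩ | ⟨M, h⟩
    · exact .inl ⟨M, fun t ht => ⟨t, le_rfl, h t ht, fun m _ _ => by omega⟩⟩
    · rcases ih with ⟨M', h'⟩ | ⟨M', h'⟩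
      -- With `χ` eventually false and `ψ` eventually true, the expansion law just copies the
      -- previous value.
      · have hc : ∀ t, max M M' ≤ t → (Holds σ (S ψ χ) t ↔ Holds σ (S ψ χ) (max M M')) := by
          intro t ht
          induction t, ht using Nat.le_induction with
          | base => rfl
          | succ t ht iht =>
            rw [holds_since_succ, ← iht]
            simp [h (t + 1) (by omega), h' (t + 1) (by omega)]
        by_cases hM : Holds σ (S ψ χ) (max M M')
        · exact .inl ⟨_, fun t ht => (hc t ht).2 hM⟩
        · exact .inr ⟨_, fun t ht => mt (hc t ht).1 hM⟩
      · refine .inr ⟨max M M', fun t ht ⟨j, h1, h2, h3⟩ => ?_⟩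
        rcases h1.eq_or_lt with rfl | hlt
        · exact h j (by omega) h2
        · exact h' t (by omega) (h3 t hlt le_rfl)

theorem exists_forall_holds_const {N : ℕ} (hσ : ∀ t, N ≤ t → σ t = σ N) (L : List (LTL P)) :
    ∃ M, ∀ ψ ∈ L, ∀ t, M ≤ t → (Holds σ ψ t ↔ Holds σ ψ M) := by
  induction L with
  | nil => exact ⟨0, by simp⟩
  | cons ψ L ih =>
    obtain ⟨M, hM⟩ := ih
    obtain ⟨M', hM'⟩ : ∃ M', ∀ t, M' ≤ t → (Holds σ ψ t ↔ Holds σ ψ M') := by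
      rcases holds_eventually_const hσ ψ with ⟨M', h⟩ | ⟨M', h⟩
      · exact ⟨M', fun t ht => iff_of_true (h t ht) (h _ le_rfl)⟩
      · exact ⟨M', fun t ht => iff_of_false (h t ht) (h _ le_rfl)⟩
    refine ⟨max M M', fun χ hχ t ht => ?_⟩
    rcases List.mem_cons.1 hχ with rfl | hχ
    · rw [hM' t (by omega), hM' (max M M') (by omega)]
    · rw [hM χ hχ t (by omega), hM χ hχ (max M M') (by omega)]

end LTL

/-! ### The bounded encodings: soundness, completeness, shortening, finiteness. -/

namespace BMC

open PForm LTL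

variable {P : Type*} {v : BVar P → Prop} {φ ψ : LTL P} {k l i : ℕ}

theorem eval_formulaConstraints : Eval v (formulaConstraints φ k) ↔
    ∀ i ≤ k, ∀ ψ ∈ φ.subs, Eval v (step 0 i ψ) ∧
      ∀ d < φ.pastDepth, v (.inLoop i) → Eval v (step (d + 1) i ψ) := by
  simp [formulaConstraints, eval_all, Eval]

theorem eval_loopConstraints : Eval v (loopConstraints k) ↔
    (v (.inLoop 0) ↔ v (.loop 0)) ∧
      ∀ i < k, (v (.inLoop (i + 1)) ↔ v (.inLoop i) ∨ v (.loop (i + 1))) ∧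
        (v (.inLoop i) → ¬ v (.loop (i + 1))) := by
  simp [loopConstraints, eval_all, Eval]

theorem eval_eventConstraints : Eval v (eventConstraints φ k) ↔
    ∀ u ∈ φ.untils, (v (.ev u.2 0) ↔ v (.inLoop 0) ∧ v (.sub u.2 φ.pastDepth 0)) ∧
      ∀ i < k, (v (.ev u.2 (i + 1)) ↔
        v (.ev u.2 i) ∨ v (.inLoop (i + 1)) ∧ v (.sub u.2 φ.pastDepth (i + 1))) := by
  simp [eventConstraints, eval_all, Eval]

theorem eval_pathEnc : Eval v (pathEnc φ k) ↔
    v (.sub φ 0 0) ∧ Eval v (formulaConstraints φ k) ∧ Eval v (loopConstraints k) ∧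
      Eval v (eventConstraints φ k) := Iff.rfl

theorem eval_closeEnc : Eval v (closeEnc φ k) ↔
    v (.inLoop k) ∧
    (∀ ψ ∈ φ.subs, ∀ d ≤ φ.pastDepth, (v (.subEnd ψ d) ↔ v (.sub ψ d k)) ∧
      ∀ i ≤ k, v (.loop i) →
        (v (.sub ψ d (k + 1)) ↔ v (.sub ψ (min (d + 1) φ.pastDepth) i))) ∧
    ∀ u ∈ φ.untils, v (.sub (.U u.1 u.2) φ.pastDepth k) → v (.ev u.2 k) := by
  simp [closeEnc, eval_all, Eval]

theorem eval_sameState {i j : ℕ} : Eval v (sameState φ i j) ↔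
    (v (.inLoop i) ↔ v (.inLoop j)) ∧
    (∀ ψ ∈ φ.subs, (v (.sub ψ 0 i) ↔ v (.sub ψ 0 j))) ∧
    (v (.inLoop i) →
      (∀ ψ ∈ φ.subs, ∀ d < φ.pastDepth, (v (.sub ψ (d + 1) i) ↔ v (.sub ψ (d + 1) j))) ∧
      ∀ u ∈ φ.untils, (v (.ev u.2 i) ↔ v (.ev u.2 j))) := by
  simp [sameState, eval_all, Eval]

theorem eval_simplePath : Eval v (simplePath φ k) ↔
    ∀ j ≤ k, ∀ i < j, ¬ Eval v (sameState φ i j) := by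
  simp [simplePath, eval_all, Eval]

/-- Works because a path encoding leaves its values at time `k + 1` open; a longer path may supply
any values there. -/
theorem eval_pathEnc_mono {j : ℕ} (hkj : k ≤ j) (h : Eval v (pathEnc φ j)) :
    Eval v (pathEnc φ k) := by
  rw [eval_pathEnc, eval_formulaConstraints, eval_loopConstraints, eval_eventConstraints] at h ⊢
  obtain ⟨h1, h2, h3, h4⟩ := h
  exact ⟨h1, fun i hi => h2 i (hi.trans hkj), ⟨h3.1, fun i hi => h3.2 i (hi.trans_le hkj)⟩,
    fun u hu => ⟨(h4 u hu).1, fun i hi => (h4 u hu).2 i (hi.trans_le hkj)⟩⟩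

/-- If time `k` is in the loop, then the loop is an interval that begins at a unique start. -/
theorem exists_loopStart (h : Eval v (loopConstraints k)) (hk : v (.inLoop k)) :
    ∃ l ≤ k, ∀ i ≤ k, (v (.inLoop i) ↔ l ≤ i) ∧ (v (.loop i) ↔ i = l) := by
  rw [eval_loopConstraints] at h
  obtain ⟨h0, h⟩ := h
  -- Invariant: up to `m` either no loop has begun, or exactly one has and it has not been left.
  have key : ∀ m ≤ k, (¬ v (.inLoop m) ∧ ∀ i ≤ m, ¬ v (.inLoop i) ∧ ¬ v (.loop i)) ∨
      ∃ l ≤ m, ∀ i ≤ m, (v (.inLoop i) ↔ l ≤ i) ∧ (v (.loop i) ↔ i = l) := by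
    intro m
    induction m with
    | zero =>
      intro _
      by_cases hl : v (.loop 0)
      · exact .inr ⟨0, le_rfl, fun i hi => by simp [Nat.le_zero.1 hi, hl, h0]⟩
      · refine .inl ⟨by rwa [h0], fun i hi => ?_⟩
        rw [Nat.le_zero.1 hi, h0]
        exact ⟨hl, hl⟩
    | succ m ih =>
      intro hm
      obtain ⟨h1, h2⟩ := h m (by omega)
      rcases ih (by omega) with ⟨h3, h4⟩ | ⟨l, hl, h3⟩
      · by_cases hl : v (.loop (m + 1))
        · refine .inr ⟨m + 1, le_rfl, fun i hi => ?_⟩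
          rcases hi.eq_or_lt with rfl | hlt
          · simp [h1, hl]
          · have := h4 i (by omega)
            exact ⟨iff_of_false this.1 (by omega), iff_of_false this.2 (by omega)⟩
        · have h5 : ¬ v (.inLoop (m + 1)) := by rw [h1]; tauto
          refine .inl ⟨h5, fun i hi => ?_⟩
          rcases hi.eq_or_lt with rfl | hlt
          · exact ⟨h5, hl⟩
          · exact h4 i (by omega)
      · have h5 : v (.inLoop m) := (h3 m le_rfl).1.2 hl
        refine .inr ⟨l, by omega, fun i hi => ?_⟩
        rcases hi.eq_or_lt with rfl | hlt
        · exact ⟨iff_of_true (h1.2 (.inl h5)) (by omega), iff_of_false (h2 h5) (by omega)⟩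
        · exact h3 i (by omega)
  rcases key k le_rfl with h | h
  · exact absurd hk h.1
  · exact h

theorem exists_of_ev (h : Eval v (eventConstraints φ k)) {u : LTL P × LTL P} (hu : u ∈ φ.untils) :
    ∀ m ≤ k, v (.ev u.2 m) → ∃ i ≤ m, v (.inLoop i) ∧ v (.sub u.2 φ.pastDepth i) := by
  rw [eval_eventConstraints] at h
  intro m
  induction m with
  | zero => exact fun _ he => ⟨0, le_rfl, (h u hu).1.1 he⟩
  | succ m ih =>
    intro hm he
    rcases ((h u hu).2 m (by omega)).1 he with he | he
    · obtain ⟨i, hi, h⟩ := ih (by omega) he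
      exact ⟨i, by omega, h⟩
    · exact ⟨m + 1, le_rfl, he⟩

/-- The time on the lasso `[0, k]` with loop start `l` and loop length `p` that time `t` of the
unrolled trace corresponds to. -/
def lassoTime (l p t : ℕ) : ℕ := if t < l then t else l + (t - l) % p

/-- The virtual unrolling, at most `δ`, that time `t` of the unrolled trace belongs to. -/
def lassoUnrolling (l p δ t : ℕ) : ℕ := min ((t - l) / p) δ

section Lasso

variable {p δ : ℕ}

theorem lassoTime_of_lt {t : ℕ} (ht : t < l) : lassoTime l p t = t := if_pos ht

theorem lassoUnrolling_of_le {t : ℕ} (ht : t ≤ l) : lassoUnrolling l p δ t = 0 := by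
  simp [lassoUnrolling, Nat.sub_eq_zero_of_le ht]

theorem lassoTime_loop {q r : ℕ} (hr : r < p) : lassoTime l p (l + (q * p + r)) = l + r := by
  rw [lassoTime, if_neg (by omega), Nat.add_sub_cancel_left, Nat.mul_add_mod_self_right,
    Nat.mod_eq_of_lt hr]

theorem lassoUnrolling_loop (hp : 0 < p) {q r : ℕ} (hr : r < p) :
    lassoUnrolling l p δ (l + (q * p + r)) = min q δ := by
  rw [lassoUnrolling, Nat.add_sub_cancel_left, Nat.mul_comm, Nat.mul_add_div hp,
    Nat.div_eq_of_lt hr, Nat.add_zero]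

theorem exists_eq_loop (hp : 0 < p) {t : ℕ} (ht : l ≤ t) : ∃ q r, r < p ∧ t = l + (q * p + r) :=
  ⟨(t - l) / p, (t - l) % p, Nat.mod_lt _ hp, by
    rw [Nat.mul_comm, Nat.div_add_mod]; omega⟩

end Lasso

/-- Soundness of the witness formula. -/
theorem exists_holds_of_encP (h : Eval v (encP φ k)) :
    ∃ σ : ℕ → Set P, Holds σ φ 0 ∧ ∀ x, x ∈ σ 0 ↔ v (.state x 0) := by
  obtain ⟨hpath, hclose⟩ := h
  obtain ⟨hinit, hform, hloop, hev⟩ := eval_pathEnc.1 hpath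
  obtain ⟨hin, hend, hunt⟩ := eval_closeEnc.1 hclose
  obtain ⟨l, hlk, hl⟩ := exists_loopStart hloop hin
  rw [eval_formulaConstraints] at hform
  obtain ⟨p, rfl⟩ : ∃ p, k = l + p := ⟨k - l, by omega⟩
  have hp : 0 < p + 1 := p.succ_pos
  set δ := φ.pastDepth with hδ
  -- Time `t` of the unrolled trace reads its labels at lasso time `f t` in unrolling `g t`. The
  -- loop `[l, l + p]` has length `p + 1`, and `g` stays at `δ` once it is reached.
  let f := lassoTime l (p + 1)
  let g := lassoUnrolling l (p + 1) δ
  have hf : ∀ t, t < l → f t = t := fun t ht => lassoTime_of_lt ht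
  have hg : ∀ t, t ≤ l → g t = 0 := fun t ht => lassoUnrolling_of_le ht
  have hfl : ∀ q r, r < p + 1 → f (l + (q * (p + 1) + r)) = l + r :=
    fun q r hr => lassoTime_loop hr
  have hgl : ∀ q r, r < p + 1 → g (l + (q * (p + 1) + r)) = min q δ :=
    fun q r hr => lassoUnrolling_loop hp hr
  have hf0 : f 0 = 0 := by
    rcases Nat.eq_zero_or_pos l with h | h
    · have := hfl 0 0 hp
      simpa [h] using this
    · exact hf 0 h
  have hg0 : g 0 = 0 := hg 0 (Nat.zero_le _)
  have hper : ∀ t, l ≤ t → f (t + (p + 1)) = f t := by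
    intro t ht
    obtain ⟨q, r, hr, rfl⟩ := exists_eq_loop hp ht
    have := hfl (q + 1) r hr
    rw [hfl q r hr, ← this]
    congr 1; ring
  have hperg : ∀ t, l + δ * (p + 1) ≤ t → g (t + (p + 1)) = g t := by
    intro t ht
    obtain ⟨q, r, hr, rfl⟩ := exists_eq_loop hp ((Nat.le_add_right _ _).trans ht)
    have := hgl (q + 1) r hr
    have hq : δ < q + 1 := by
      by_contra hc
      have := Nat.mul_le_mul_right (p + 1) (not_lt.1 hc)
      rw [Nat.add_mul, one_mul] at this
      omega
    rw [hgl q r hr, show min q δ = min (q + 1) δ by omega, ← this]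
    congr 1; ring
  have hfk : ∀ t, f t ≤ l + p := by
    intro t
    rcases lt_or_ge t l with ht | ht
    · rw [hf t ht]; omega
    · obtain ⟨q, r, hr, rfl⟩ := exists_eq_loop hp ht
      rw [hfl q r hr]; omega
  have hgδ : ∀ t, g t ≤ δ := fun t => min_le_right _ _
  have hfg : ∀ t, g t = 0 ∨ l ≤ f t := by
    intro t
    rcases lt_or_ge t l with ht | ht
    · exact .inl (hg t ht.le)
    · obtain ⟨q, r, hr, rfl⟩ := exists_eq_loop hp ht
      rw [hfl q r hr]; omega
  have hstep : ∀ ψ ∈ φ.subs, ∀ t, Eval v (step (g t) (f t) ψ) := by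
    intro ψ hψ t
    obtain ⟨h1, h2⟩ := hform (f t) (hfk t) ψ hψ
    rcases Nat.eq_zero_or_pos (g t) with h | h
    · rwa [h]
    · have := h2 (g t - 1) (by have := hgδ t; omega)
        ((hl _ (hfk t)).1.2 ((hfg t).resolve_left h.ne'))
      rwa [Nat.sub_add_cancel h] at this
  -- A step either advances on the lasso or wraps from its end to the loop start. The last clause
  -- says that wraps before the end of unrolling `δ` really increase the unrolling.
  have hsucc : ∀ t, (f (t + 1) = f t + 1 ∧ g (t + 1) = g t) ∨
      (f t = l + p ∧ f (t + 1) = l ∧ g (t + 1) = min (g t + 1) δ ∧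
        (t + 1 < l + (δ + 1) * (p + 1) → g t < δ)) := by
    intro t
    rcases lt_or_ge t l with ht | ht
    · rcases (Nat.succ_le_of_lt ht).eq_or_lt with h | h
      · have h1 := hfl 0 0 hp
        have h2 : t + 1 = l := h
        refine .inl ⟨?_, by rw [hg t ht.le, hg _ h2.le]⟩
        rw [hf t ht, h2]
        simpa using h1
      · exact .inl ⟨by rw [hf t ht, hf _ h], by rw [hg t ht.le, hg _ (le_of_lt h)]⟩
    · obtain ⟨q, r, hr, rfl⟩ := exists_eq_loop hp ht
      by_cases hrp : r < p
      · left
        rw [show l + (q * (p + 1) + r) + 1 = l + (q * (p + 1) + (r + 1)) by ring, hfl q r hr,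
          hgl q r hr, hfl q (r + 1) (by omega), hgl q (r + 1) (by omega)]
        exact ⟨rfl, rfl⟩
      · right
        obtain rfl : r = p := by omega
        have e : l + (q * (r + 1) + r) + 1 = l + ((q + 1) * (r + 1) + 0) := by ring
        rw [e, hfl q r hr, hgl q r hr, hfl (q + 1) 0 hp, hgl (q + 1) 0 hp]
        refine ⟨rfl, rfl, by omega, fun h => ?_⟩
        have h' : (q + 1) * (r + 1) < (δ + 1) * (r + 1) := by omega
        have := Nat.lt_of_mul_lt_mul_right h'
        omega
  let w : ℕ → LTL P → Prop := fun t ψ => v (.sub ψ (g t) (f t))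
  let σ : ℕ → Set P := fun t => {x | v (.state x (f t))}
  have hnext : ∀ ψ ∈ φ.subs, ∀ t, v (.sub ψ (g t) (f t + 1)) ↔ w (t + 1) ψ := by
    intro ψ hψ t
    rcases hsucc t with ⟨h1, h2⟩ | ⟨h1, h2, h3, -⟩
    · simp only [w, h1, h2]
    · simp only [w, h1, h2, h3]
      exact (hend ψ hψ (g t) (hgδ t)).2 l hlk ((hl l hlk).2.2 rfl)
  have hpred0 : ∀ ψ, ¬ Eval v (pred ψ (g 0) (f 0)) := by
    intro ψ
    rw [hf0, hg0]
    exact id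
  -- The bound is essential: a later wrap stays in unrolling `δ`, but `pred` at the loop start does
  -- not read the end of that same unrolling.
  have hpred : ∀ ψ ∈ φ.subs, ∀ t, t + 1 < l + (δ + 1) * (p + 1) →
      (Eval v (pred ψ (g (t + 1)) (f (t + 1))) ↔ w t ψ) := by
    intro ψ hψ t ht
    rcases hsucc t with ⟨h1, h2⟩ | ⟨h1, h2, h3, h4⟩
    · rw [h1, h2]
      rcases hd : g t with _ | d
      · simp only [pred, Eval, w, hd]
      · have hlf : l ≤ f t := (hfg t).resolve_left (by omega)
        have hnl : ¬ v (.loop (f t + 1)) := by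
          rw [(hl (f t + 1) (by rw [← h1]; exact hfk _)).2]
          omega
        simp [pred, Eval, w, hd, hnl]
    · have h5 := h4 ht
      rw [h2, h3, min_eq_left (by omega)]
      have h6 : v (.loop l) := (hl l hlk).2.2 rfl
      have h7 := (hend ψ hψ (g t) (hgδ t)).1
      rcases l with _ | l
      · simpa only [pred, Eval, w, h1] using h7
      · simpa only [pred, Eval, w, h1, h6, true_and, not_true, false_and, or_false] using h7
  have hlabel := label_iff_holds (φ := φ) (σ := σ) (l := l) (p := p + 1) (δ := δ) hp
    (fun t ht => by simp only [σ, hper t ht]) (w := w) le_rfl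
    (fun ψ _ t ht => by
      simp only [w, hper t ((Nat.le_add_right _ _).trans ht), hperg t ht])
    (fun h t => hstep _ h t) (fun x h t => hstep _ h t) (fun ψ h t => hstep _ h t)
    (fun ψ χ h t => hstep _ h t)
    (fun ψ h t => (hstep _ h t).trans (hnext _ (next_arg_mem h) t))
    (fun ψ χ h t => (hstep _ h t).trans (or_congr_right (and_congr_right' (hnext _ h t))))
    ?_ (fun ψ h h' => hpred0 ψ ((hstep _ h 0).1 h'))
    (fun ψ h t ht => (hstep _ h (t + 1)).trans (hpred _ (yesterday_arg_mem h) t ht))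
    (fun ψ χ h => (hstep _ h 0).trans (or_iff_left fun h' => hpred0 _ h'.2))
    (fun ψ χ h t ht => (hstep _ h (t + 1)).trans
      (or_congr_right (and_congr_right' (hpred _ h t ht))))
  · refine ⟨σ, (hlabel φ (self_mem_subs φ) 0).1 ?_, fun x => ?_⟩
    · simpa only [w, hf0, hg0] using hinit
    · change v (.state x (f 0)) ↔ _
      rw [hf0]
  · intro ψ χ h t ht
    -- Loop iteration `t + δ` begins no earlier than `t` and is labelled by unrolling `δ`. The until
    -- holds at its end, so the flag yields a loop time `i` where `χ` holds, read in this same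
    -- iteration.
    have hq : t + δ ≤ (t + δ) * (p + 1) := Nat.le_mul_of_pos_right _ hp
    have h1 := ht (l + ((t + δ) * (p + 1) + p)) (by omega)
    have hlt : p < p + 1 := p.lt_succ_self
    simp only [w, hfl _ p hlt, hgl _ p hlt, min_eq_right (Nat.le_add_left δ t)] at h1
    have hu : (ψ, χ) ∈ φ.untils := mem_untils.2 h
    obtain ⟨i, hi, h2, h3⟩ := exists_of_ev hev hu _ le_rfl (hunt _ hu h1)
    have hli := (hl i hi).1.1 h2
    refine ⟨l + ((t + δ) * (p + 1) + (i - l)), by omega, ?_⟩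
    simp only [w, hfl _ (i - l) (by omega), hgl _ (i - l) (by omega : i - l < p + 1),
      min_eq_right (Nat.le_add_left δ t)]
    rwa [Nat.add_sub_cancel' hli]

/-- Completeness of the witness formula for eventually constant traces. -/
theorem exists_encP_of_holds {σ : ℕ → Set P} {N : ℕ} (hσ : ∀ t, N ≤ t → σ t = σ N)
    (h : Holds σ φ 0) :
    ∃ k v, Eval v (encP φ k) ∧ ∀ x, v (.state x 0) ↔ x ∈ σ 0 := by
  obtain ⟨M, hM⟩ := exists_forall_holds_const hσ φ.subs
  -- Every unrolling carries the true values, with a self-loop at `M + 1`. Starting one step after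
  -- `M` makes the true predecessor `M` agree with `subEnd`, the value at `M + 1`.
  let v : BVar P → Prop := fun
    | .state x t => x ∈ σ t
    | .sub ψ _ t => Holds σ ψ t
    | .subEnd ψ _ => Holds σ ψ (M + 1)
    | .ev ψ t => M + 1 ≤ t ∧ Holds σ ψ t
    | .loop t => t = M + 1
    | .inLoop t => M + 1 ≤ t
  have hv : ∀ ψ d t, v (.sub ψ d t) ↔ Holds σ ψ t := fun _ _ _ => Iff.rfl
  have hpred : ∀ ψ ∈ φ.subs, ∀ d t, (d = 0 ∨ M + 1 = t) →
      (Eval v (pred ψ d t) ↔ ∃ j, j + 1 = t ∧ Holds σ ψ j) := by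
    intro ψ hψ d t hd
    rcases d with _ | d
    · rcases t with _ | t
      · simp [pred, Eval]
      · simp [pred, Eval, hv]
    · obtain rfl : M + 1 = t := by omega
      have h1 : v (.subEnd ψ d) ↔ Holds σ ψ M := hM ψ hψ _ (Nat.le_succ M)
      have h2 : v (.loop (M + 1)) := rfl
      simp [pred, Eval, h1, h2]
  have hstep : ∀ ψ ∈ φ.subs, ∀ d t, (d = 0 ∨ M + 1 = t) → Eval v (step d t ψ) := by
    intro ψ hψ d t hd
    cases ψ with
    | tru => exact trivial
    | atom x => exact Iff.rfl
    | neg ψ => exact Iff.rfl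
    | and ψ χ => exact Iff.rfl
    | X ψ => exact Iff.rfl
    | U ψ χ => exact holds_until_iff
    | Y ψ => exact (hpred ψ (yesterday_arg_mem hψ) d t hd).symm
    | S ψ χ =>
      have := hpred _ hψ d t hd
      simp only [step, Eval, hv, this]
      rcases t with _ | t
      · simp [holds_since_zero]
      · simp [holds_since_succ]
  refine ⟨M + 1, v, ⟨eval_pathEnc.2 ⟨h, ?_, ?_, ?_⟩, eval_closeEnc.2 ⟨?_, ?_, ?_⟩⟩,
    fun _ => Iff.rfl⟩
  · rw [eval_formulaConstraints]
    exact fun t ht ψ hψ => ⟨hstep ψ hψ 0 t (.inl rfl),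
      fun d _ hin => hstep ψ hψ _ t (.inr (le_antisymm hin ht))⟩
  · rw [eval_loopConstraints]
    simp only [v]
    exact ⟨by omega, fun t ht => by omega⟩
  · rw [eval_eventConstraints]
    simp only [v]
    refine fun u _ => ⟨by tauto, fun t ht => ?_⟩
    have : ¬ M + 1 ≤ t := by omega
    simp [this]
  · exact le_refl (M + 1)
  · refine fun ψ hψ d _ => ⟨Iff.rfl, fun t _ ht => ?_⟩
    obtain rfl : t = M + 1 := ht
    simp only [hv]
    rw [hM ψ hψ _ (by omega), hM ψ hψ (M + 1) (by omega)]
  · rintro ⟨ψ, χ⟩ hu ⟨j, h1, h2, -⟩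
    have hχ := until_right_mem (mem_untils.1 hu)
    exact ⟨le_rfl, (hM χ hχ _ (by omega)).2 ((hM χ hχ j (by omega)).1 h2)⟩

/-- If the times `i < j` of a witness carry the same extended state, then the part between them can
be cut out. -/
theorem exists_encP_of_sameState {i j : ℕ} (hij : i < j) (hjk : j ≤ k) (h : Eval v (encP φ k))
    (hsame : Eval v (sameState φ i j)) :
    ∃ v' : BVar P → Prop, Eval v' (encP φ (k - (j - i))) ∧
      ∀ x, v' (.state x 0) ↔ v (.state x 0) := by
  obtain ⟨hpath, hclose⟩ := h
  obtain ⟨hinit, hform, hloop, hev⟩ := eval_pathEnc.1 hpath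
  have hloop' := hloop
  have hev' := hev
  rw [eval_formulaConstraints] at hform
  rw [eval_loopConstraints] at hloop'
  rw [eval_eventConstraints] at hev'
  obtain ⟨hin, hend, hunt⟩ := eval_closeEnc.1 hclose
  obtain ⟨l, hlk, hl⟩ := exists_loopStart hloop hin
  obtain ⟨hs1, hs2, hs3⟩ := eval_sameState.1 hsame
  -- `f` skips the times `i + 1, …, j`, and `g` skips `i, …, j - 1`. They differ only at `i`, where
  -- they give the two equal extended states, and `f (t + 1) = g t + 1` holds throughout: `g t` is
  -- the old predecessor of the next kept time.
  let f : ℕ → ℕ := fun t => if t ≤ i then t else t + (j - i)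
  let g : ℕ → ℕ := fun t => if t < i then t else t + (j - i)
  obtain ⟨m, rfl⟩ : ∃ m, k = m + (j - i) := ⟨k - (j - i), by omega⟩
  have him : i ≤ m := by omega
  rw [Nat.add_sub_cancel]
  have hf0 : f 0 = 0 := if_pos (Nat.zero_le _)
  have hfs : ∀ t, f (t + 1) = g t + 1 := fun t => by simp only [f, g]; split_ifs <;> omega
  have hgm : g m = m + (j - i) := if_neg (by omega)
  have hfk : ∀ t ≤ m, f t ≤ m + (j - i) := fun t ht => by simp only [f]; split_ifs <;> omega
  have hgk : ∀ t ≤ m, g t ≤ m + (j - i) := fun t ht => by simp only [g]; split_ifs <;> omega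
  have hgk' : ∀ t < m, g t < m + (j - i) := fun t ht => by simp only [g]; split_ifs <;> omega
  have hfg : ∀ t, f t = g t ∨ f t = i ∧ g t = j := fun t => by
    simp only [f, g]; split_ifs <;> omega
  have hin' : ∀ t, v (.inLoop (f t)) ↔ v (.inLoop (g t)) := by
    intro t
    rcases hfg t with h | ⟨h1, h2⟩
    · rw [h]
    · rw [h1, h2, hs1]
  have hsub : ∀ ψ ∈ φ.subs, ∀ d ≤ φ.pastDepth, ∀ t, (d = 0 ∨ v (.inLoop (f t))) →
      (v (.sub ψ d (f t)) ↔ v (.sub ψ d (g t))) := by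
    intro ψ hψ d hd t ht
    rcases hfg t with h | ⟨h1, h2⟩
    · rw [h]
    · rw [h1] at ht ⊢
      rw [h2]
      rcases d with _ | d
      · exact hs2 ψ hψ
      · exact (hs3 (ht.resolve_left d.succ_ne_zero)).1 ψ hψ d hd
  have hevt : ∀ u ∈ φ.untils, ∀ t, (v (.ev u.2 (f t)) ↔ v (.ev u.2 (g t))) := by
    intro u hu t
    rcases hfg t with h | ⟨h1, h2⟩
    · rw [h]
    · rw [h1, h2]
      by_cases hi : v (.inLoop i)
      · exact (hs3 hi).2 u hu
      · have hj : ¬ v (.inLoop j) := by rwa [← hs1]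
        -- Outside the loop `sameState` does not compare flags, but there all of them are still
        -- false.
        have key : ∀ s ≤ j, ¬ v (.ev u.2 s) := by
          intro s hsj he
          obtain ⟨a, ha, hb, -⟩ := exists_of_ev hev hu s (by omega) he
          rw [(hl a (by omega)).1] at hb
          rw [(hl j hjk).1] at hj
          omega
        exact iff_of_false (key i hij.le) (key j le_rfl)
  let v' : BVar P → Prop := fun
    | .state x t => v (.state x (f t))
    | .sub ψ d t => v (.sub ψ d (f t))
    | .subEnd ψ d => v (.subEnd ψ d)
    | .ev ψ t => v (.ev ψ (f t))
    | .loop t => v (.loop (f t))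
    | .inLoop t => v (.inLoop (f t))
  have hpred : ∀ ψ ∈ φ.subs, ∀ d ≤ φ.pastDepth, ∀ t ≤ m, (d = 0 ∨ v (.inLoop (f t))) →
      (Eval v' (pred ψ d t) ↔ Eval v (pred ψ d (f t))) := by
    intro ψ hψ d hd t ht hdt
    rcases t with _ | t
    · rw [hf0]
      cases d <;> exact Iff.rfl
    · rcases d with _ | d
      · rw [hfs]
        exact hsub ψ hψ 0 hd t (.inl rfl)
      · have h1 := hdt.resolve_left d.succ_ne_zero
        have h2 := (hloop'.2 (g t) (hgk' t ht)).1
        rw [← hfs, ← hin'] at h2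
        have h3 := hsub ψ hψ (d + 1) hd t
        have h4 : Eval v' (pred ψ (d + 1) (t + 1)) ↔
          v (.loop (f (t + 1))) ∧ v (.subEnd ψ d) ∨
            ¬ v (.loop (f (t + 1))) ∧ v (.sub ψ (d + 1) (f t)) := Iff.rfl
        have h5 : Eval v (pred ψ (d + 1) (g t + 1)) ↔
          v (.loop (g t + 1)) ∧ v (.subEnd ψ d) ∨
            ¬ v (.loop (g t + 1)) ∧ v (.sub ψ (d + 1) (g t)) := Iff.rfl
        rw [h4, hfs, h5, ← hfs]
        by_cases hlp : v (.loop (f (t + 1)))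
        · simp only [hlp, true_and, not_true, false_and, or_false]
        · simp only [hlp, false_and, not_false_eq_true, true_and, false_or]
          exact h3 (.inr ((h2.1 h1).resolve_right hlp))
  have hstep : ∀ ψ ∈ φ.subs, ∀ d ≤ φ.pastDepth, ∀ t ≤ m, (d = 0 ∨ v (.inLoop (f t))) →
      Eval v' (step d t ψ) := by
    intro ψ hψ d hd t ht hdt
    have key : ∀ s ≤ m + (j - i), (d = 0 ∨ v (.inLoop s)) → Eval v (step d s ψ) := by
      intro s hs hds
      rcases d with _ | d
      · exact (hform s hs ψ hψ).1
      · exact (hform s hs ψ hψ).2 d hd (hds.resolve_left d.succ_ne_zero)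
    -- Present and past laws are transported from `f t`; the laws that look at the next time are
    -- transported from `g t`, whose old successor is the new one.
    have k1 := key (f t) (hfk t ht) hdt
    have k2 := key (g t) (hgk t ht) (by rwa [← hin'])
    have h0 : ∀ χ s, v' (.sub χ d s) ↔ v (.sub χ d (f s)) := fun _ _ => Iff.rfl
    cases ψ with
    | tru => exact k1
    | atom x => exact k1
    | neg ψ => exact k1
    | and ψ χ => exact k1
    | X ψ =>
      simp only [step, Eval, h0, hfs] at k2 ⊢
      rw [hsub _ hψ d hd t hdt, k2]
    | U ψ χ =>
      simp only [step, Eval, h0, hfs] at k2 ⊢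
      rw [hsub _ hψ d hd t hdt, hsub _ (until_left_mem hψ) d hd t hdt,
        hsub _ (until_right_mem hψ) d hd t hdt, k2]
    | Y ψ => exact k1.trans (hpred ψ (yesterday_arg_mem hψ) d hd t ht hdt).symm
    | S ψ χ =>
      exact k1.trans (or_congr_right (and_congr_right' (hpred _ hψ d hd t ht hdt).symm))
  refine ⟨v', ⟨eval_pathEnc.2 ⟨?_, ?_, ?_, ?_⟩, eval_closeEnc.2 ⟨?_, ?_, ?_⟩⟩, fun x => ?_⟩
  · simpa only [v', hf0] using hinit
  · rw [eval_formulaConstraints]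
    exact fun t ht ψ hψ => ⟨hstep ψ hψ 0 (Nat.zero_le _) t ht (.inl rfl),
      fun d hd hin => hstep ψ hψ (d + 1) hd t ht (.inr hin)⟩
  · rw [eval_loopConstraints]
    simp only [v', hf0, hfs]
    refine ⟨hloop'.1, fun t ht => ?_⟩
    rw [hin']
    exact hloop'.2 (g t) (hgk' t ht)
  · rw [eval_eventConstraints]
    simp only [v', hf0, hfs]
    refine fun u hu => ⟨(hev' u hu).1, fun t ht => ?_⟩
    rw [hevt u hu]
    exact (hev' u hu).2 (g t) (hgk' t ht)
  · simp only [v']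
    rwa [hin', hgm]
  · intro ψ hψ d hd
    obtain ⟨h1, h2⟩ := hend ψ hψ d hd
    simp only [v', hfs, hgm]
    refine ⟨?_, fun t ht => h2 _ (hfk t ht)⟩
    rw [hsub ψ hψ d hd m (.inr (by rwa [hin', hgm])), hgm]
    exact h1
  · intro u hu
    simp only [v']
    rw [hsub _ (mem_untils.1 hu) _ le_rfl m (.inr (by rwa [hin', hgm])), hevt u hu, hgm]
    exact hunt u hu
  · simp only [v', hf0]

/-- If some witness satisfies the assumptions `L` on the first state, then so does every
completeness formula. -/
theorem encC_satUnder_of_encP {L : Set (BVar P)} (hL : ∀ y ∈ L, ∃ x, y = .state x 0)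
    (h : ∃ j, (encP φ j).SatUnder L) (k : ℕ) : (encC φ k).SatUnder L := by
  classical
  -- Take a shortest witness. Cutting preserves the first state, hence the assumptions, so a
  -- repetition would give a shorter one.
  obtain ⟨v, hv, hvL⟩ := Nat.find_spec h
  by_cases hk : Nat.find h < k
  · exact ⟨v, .inr (eval_any.2 ⟨_, List.mem_range.2 hk, hv⟩), hvL⟩
  · refine ⟨v, .inl ⟨eval_pathEnc_mono (not_lt.1 hk) hv.1, eval_simplePath.2 ?_⟩, hvL⟩
    intro j hj i hij hsame
    obtain ⟨v', hv', hst⟩ := exists_encP_of_sameState hij (hj.trans (not_lt.1 hk)) hv hsame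
    refine Nat.find_min h (m := Nat.find h - (j - i)) (by omega) ⟨v', hv', fun y hy => ?_⟩
    obtain ⟨x, rfl⟩ := hL y hy
    exact (hst x).2 (hvL _ hy)

/-- Only boundedly many extended states are pairwise distinct. -/
theorem exists_not_simplePath (φ : LTL P) : ∃ k, ∀ v : BVar P → Prop,
    ¬ Eval v (simplePath φ k) := by
  classical
  let s := φ.subs.toFinset
  let D := Fin (φ.pastDepth + 1)
  let e := φ.untils.toFinset
  -- A finite type whose equality is finer than `sameState`: it also compares the unrollings and
  -- flags outside the loop.
  let E := Prop × (s → D → Prop) × (e → Prop)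
  refine ⟨Fintype.card E, fun v hv => ?_⟩
  let F : Fin (Fintype.card E + 1) → E := fun t =>
    (v (.inLoop t), fun ψ d => v (.sub ψ.1 d t), fun u => v (.ev u.1.2 t))
  obtain ⟨a, b, hab, hF⟩ := Fintype.exists_ne_map_eq_of_card_lt F (by simp)
  rw [eval_simplePath] at hv
  have key : ∀ a b : Fin (Fintype.card E + 1), F a = F b → a < b → False := by
    intro a b hF hab
    refine hv b (by omega) a hab (eval_sameState.2 ?_)
    have h1 : v (.inLoop a) = v (.inLoop b) := congrArg Prod.fst hF
    have h2 := congrArg (fun x => x.2.1) hF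
    have h3 := congrArg (fun x => x.2.2) hF
    have h4 : ∀ ψ ∈ φ.subs, ∀ d ≤ φ.pastDepth, (v (.sub ψ d a) ↔ v (.sub ψ d b)) :=
      fun ψ hψ d hd => iff_of_eq
        (congrFun (congrFun h2 ⟨ψ, List.mem_toFinset.2 hψ⟩) ⟨d, Nat.lt_succ_of_le hd⟩)
    exact ⟨iff_of_eq h1, fun ψ hψ => h4 ψ hψ 0 (Nat.zero_le _),
      fun _ => ⟨fun ψ hψ d hd => h4 ψ hψ (d + 1) hd,
        fun u hu => iff_of_eq (congrFun h3 ⟨u, List.mem_toFinset.2 hu⟩)⟩⟩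
  rcases lt_or_gt_of_ne hab with h | h
  · exact key a b hF h
  · exact key b a hF.symm h

end BMC

/-! ### Truth of the derived operators. -/

namespace LTL

variable {P : Type*} {σ : ℕ → Set P} {φ ψ : LTL P} {i : ℕ}

theorem holds_or : Holds σ (φ.or ψ) i ↔ Holds σ φ i ∨ Holds σ ψ i := by
  simp only [LTL.or, Holds]; tauto

theorem holds_imp : Holds σ (φ.imp ψ) i ↔ (Holds σ φ i → Holds σ ψ i) := by
  simp only [imp, holds_or, Holds]; tauto

theorem holds_F : Holds σ φ.F i ↔ ∃ j, i ≤ j ∧ Holds σ φ j := by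
  simp [LTL.F, Holds]

theorem holds_G : Holds σ φ.G i ↔ ∀ j, i ≤ j → Holds σ φ j := by
  simp only [LTL.G, holds_F, Holds, not_exists, not_and, not_not]

theorem holds_R : Holds σ (φ.R ψ) i ↔
    ∀ j, i ≤ j → Holds σ ψ j ∨ ∃ m, i ≤ m ∧ m < j ∧ Holds σ φ m := by
  simp only [LTL.R, Holds, not_exists, not_and]
  refine forall₂_congr fun j hj => ?_
  by_cases h : Holds σ ψ j <;> simp [h]

theorem holds_Z : Holds σ φ.Z i ↔ ∀ j, j + 1 = i → Holds σ φ j := by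
  simp only [LTL.Z, Holds, not_exists, not_and, not_not]

theorem holds_O : Holds σ φ.O i ↔ ∃ j, j ≤ i ∧ Holds σ φ j := by
  simp [LTL.O, Holds]

theorem holds_H : Holds σ φ.H i ↔ ∀ j, j ≤ i → Holds σ φ j := by
  simp only [LTL.H, holds_O, Holds, not_exists, not_and, not_not]

theorem holds_T : Holds σ (φ.T ψ) i ↔
    ∀ j, j ≤ i → Holds σ ψ j ∨ ∃ m, j < m ∧ m ≤ i ∧ Holds σ φ m := by
  simp only [LTL.T, Holds, not_exists, not_and]
  refine forall₂_congr fun j hj => ?_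
  by_cases h : Holds σ ψ j <;> simp [h]

end LTL

/-! ### From finite to infinite traces and back. -/

namespace LTLf

variable {V W : Type*} {n : ℕ}

theorem holds_rename {f : V → W} {π : Fin (n + 1) → Set W} (φ : LTLf V) (i : Fin (n + 1)) :
    Holds π (rename f φ) i ↔ Holds (fun t => f ⁻¹' π t) φ i := by
  induction φ generalizing i with
  | tru => rfl
  | atom x => rfl
  | _ => simp only [rename, Holds, *]

theorem holds_activated {φ : Fin n → LTLf V} {m : ℕ} {π : Fin (m + 1) → Set (V ⊕ Fin n)}
    {i : Fin (m + 1)} :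
    Holds π (activated φ) i ↔
      ∀ a, Sum.inr a ∈ π i → Holds (fun t => Sum.inl ⁻¹' π t) (φ a) i := by
  have key : ∀ L : List (Fin n), Holds π ((L.map fun a =>
      or (neg (atom (Sum.inr a))) (rename Sum.inl (φ a))).foldr and tru) i ↔
      ∀ a ∈ L, Sum.inr a ∈ π i → Holds (fun t => Sum.inl ⁻¹' π t) (φ a) i := by
    intro L
    induction L with
    | nil => simp [Holds]
    | cons a L ih =>
      simp only [List.map_cons, List.foldr_cons, Holds, List.forall_mem_cons, ih, holds_rename,
        ← imp_iff_not_or]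
  exact (key (List.finRange n)).trans (by simp)

/-- The translation preserves truth on a trace whose marker is set after time `n` exactly. -/
theorem holds_toLTL {π : Fin (n + 1) → Set W} {σ : ℕ → Set (Option W)}
    (hend : ∀ t, none ∈ σ t ↔ n < t) (hσ : ∀ (t : Fin (n + 1)) x, some x ∈ σ t ↔ x ∈ π t)
    (φ : LTLf W) : ∀ i : Fin (n + 1), LTL.Holds σ φ.toLTL i ↔ Holds π φ i := by
  have hlt : ∀ i : Fin (n + 1), ¬ n < i := fun i => by omega
  induction φ with
  | tru => exact fun i => Iff.rfl
  | atom x => exact fun i => hσ i x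
  | neg φ ih => exact fun i => not_congr (ih i)
  | and φ ψ ih ih' => exact fun i => and_congr (ih i) (ih' i)
  | or φ ψ ih ih' => exact fun i => LTL.holds_or.trans (or_congr (ih i) (ih' i))
  | X φ ih =>
    intro i
    have hi := i.is_lt
    simp only [toLTL, Holds, LTL.Holds, hend, ← ih, Fin.exists_iff]
    grind
  | N φ ih =>
    intro i
    have hi := i.is_lt
    simp only [toLTL, Holds, LTL.holds_or, LTL.Holds, hend, ← ih, Fin.forall_iff]
    grind
  | F φ ih =>
    intro i
    have hi := i.is_lt
    simp only [toLTL, Holds, LTL.holds_F, LTL.Holds, hend, ← ih, Fin.exists_iff, Fin.le_def]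
    grind
  | G φ ih =>
    intro i
    have hi := i.is_lt
    simp only [toLTL, Holds, LTL.holds_G, LTL.holds_or, LTL.Holds, hend, ← ih, Fin.forall_iff, Fin.le_def]
    grind
  -- The left argument needs no guard: its times precede `j`, and the guard on the right argument
  -- forces `j ≤ n`. For release, times `j > n` are settled by the marker.
  | U φ ψ ih ih' =>
    intro i
    have hi := i.is_lt
    simp only [toLTL, Holds, LTL.Holds, hend, ← ih, ← ih', Fin.exists_iff, Fin.forall_iff, Fin.le_def,
      Fin.lt_def]
    grind
  | R φ ψ ih ih' =>
    intro i
    have hi := i.is_lt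
    simp only [toLTL, Holds, LTL.holds_R, LTL.holds_or, LTL.Holds, hend, ← ih, ← ih', Fin.exists_iff,
      Fin.forall_iff, Fin.le_def, Fin.lt_def]
    grind
  | Y φ ih =>
    intro i
    have hi := i.is_lt
    simp only [toLTL, Holds, LTL.Holds, ← ih, Fin.exists_iff]
    grind
  | Z φ ih =>
    intro i
    have hi := i.is_lt
    simp only [toLTL, Holds, LTL.holds_Z, ← ih, Fin.forall_iff]
    grind
  | O φ ih =>
    intro i
    have hi := i.is_lt
    simp only [toLTL, Holds, LTL.holds_O, ← ih, Fin.exists_iff, Fin.le_def]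
    grind
  | H φ ih =>
    intro i
    have hi := i.is_lt
    simp only [toLTL, Holds, LTL.holds_H, ← ih, Fin.forall_iff, Fin.le_def]
    grind
  | S φ ψ ih ih' =>
    intro i
    have hi := i.is_lt
    simp only [toLTL, Holds, LTL.Holds, ← ih, ← ih', Fin.exists_iff, Fin.forall_iff, Fin.le_def, Fin.lt_def]
    grind
  | T φ ψ ih ih' =>
    intro i
    have hi := i.is_lt
    simp only [toLTL, Holds, LTL.holds_T, ← ih, ← ih', Fin.exists_iff, Fin.forall_iff, Fin.le_def, Fin.lt_def]
    grind

theorem holds_reduced {σ : ℕ → Set (Option W)} {φ : LTLf W} :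
    LTL.Holds σ φ.reduced 0 ↔ none ∉ σ 0 ∧ (∃ t, none ∈ σ t) ∧
      (∀ t, none ∈ σ t → none ∈ σ (t + 1)) ∧ LTL.Holds σ φ.toLTL 0 := by
  simp [reduced, LTL.Holds, LTL.holds_F, LTL.holds_G, LTL.holds_imp]

/-- Pad the finite trace with `{end}` forever. The constant tail is what `exists_encP_of_holds`
requires. -/
theorem exists_holds_reduced {π : Fin (n + 1) → Set W} {φ : LTLf W} (h : Holds π φ 0) :
    ∃ (σ : ℕ → Set (Option W)) (N : ℕ), (∀ t, N ≤ t → σ t = σ N) ∧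
      LTL.Holds σ φ.reduced 0 ∧ ∀ x, some x ∈ σ 0 ↔ x ∈ π 0 := by
  let σ : ℕ → Set (Option W) := fun t => if h : t < n + 1 then some '' π ⟨t, h⟩ else {none}
  have hend : ∀ t, none ∈ σ t ↔ n < t := by
    intro t
    by_cases ht : t < n + 1
    · simp only [σ, dif_pos ht]
      exact iff_of_false (by simp) (by omega)
    · simp only [σ, dif_neg ht]
      exact iff_of_true rfl (by omega)
  have hσ : ∀ (t : Fin (n + 1)) x, some x ∈ σ t ↔ x ∈ π t := by
    intro t x
    simp only [σ, dif_pos t.is_lt]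
    simp
  refine ⟨σ, n + 1, fun t ht => ?_, holds_reduced.2 ⟨?_, ⟨n + 1, ?_⟩, fun t => ?_, ?_⟩, hσ 0⟩
  · simp only [σ, dif_neg (not_lt.2 ht), lt_irrefl, dite_false]
  · simp [hend]
  · simp [hend]
  · simp only [hend]
    omega
  · exact (holds_toLTL hend hσ φ 0).2 h

/-- Cut the trace just before the first occurrence of the marker, which is not at time `0` and
persists once it is set. -/
theorem exists_holds_of_reduced {σ : ℕ → Set (Option W)} {φ : LTLf W}
    (h : LTL.Holds σ φ.reduced 0) :
    ∃ (n : ℕ) (π : Fin (n + 1) → Set W), Holds π φ 0 ∧ ∀ x, some x ∈ σ 0 ↔ x ∈ π 0 := by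
  classical
  obtain ⟨h0, hF, hG, hφ⟩ := holds_reduced.1 h
  obtain ⟨n, hn⟩ : ∃ n, Nat.find hF = n + 1 :=
    Nat.exists_eq_succ_of_ne_zero fun hz => h0 (hz ▸ Nat.find_spec hF)
  have hend : ∀ t, none ∈ σ t ↔ n < t := by
    intro t
    constructor
    · intro ht
      have := Nat.find_min' hF ht
      omega
    · intro ht
      induction t, Nat.succ_le_of_lt ht using Nat.le_induction with
      | base =>
        have := Nat.find_spec hF
        rwa [hn] at this
      | succ t ht' ih => exact hG t (ih ht')
  let π : Fin (n + 1) → Set W := fun t => some ⁻¹' σ t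
  exact ⟨n, π, (holds_toLTL hend (fun _ _ => Iff.rfl) φ 0).1 hφ, fun _ => Iff.rfl⟩

end LTLf

/-! ### Correctness and termination of the algorithm. -/

namespace SatBMC

variable {V : Type*} {n : ℕ} {φ : Fin n → LTLf V}

theorem exists_encP_satUnder_iff {C : Finset (Fin n)} :
    (∃ k, (BMC.encP (input φ) k).SatUnder (assumptions V C)) ↔
      LTLf.Satisfiable {ψ | ∃ i ∈ C, ψ = φ i} := by
  constructor
  · rintro ⟨k, v, hv, hC⟩
    obtain ⟨σ, hσ, hst⟩ := BMC.exists_holds_of_encP hv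
    obtain ⟨m, π, hπ, hst'⟩ := LTLf.exists_holds_of_reduced hσ
    refine ⟨m, fun t => Sum.inl ⁻¹' π t, ?_⟩
    rintro _ ⟨i, hi, rfl⟩
    refine LTLf.holds_activated.1 hπ i ?_
    rw [← hst', hst]
    exact hC _ ⟨i, hi, rfl⟩
  · rintro ⟨m, π, hπ⟩
    -- Exactly the members of `C` are activated, so the remaining implications hold vacuously.
    let ρ : Fin (m + 1) → Set (V ⊕ Fin n) := fun t => Sum.inl '' π t ∪ Sum.inr '' (C : Set (Fin n))
    have hρ : LTLf.Holds ρ (LTLf.activated φ) 0 := by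
      rw [LTLf.holds_activated]
      intro i hi
      have hiC : i ∈ C := by simpa [ρ] using hi
      have he : (fun t => Sum.inl ⁻¹' ρ t) = π := by
        ext t x
        simp [ρ]
      rw [he]
      exact hπ _ ⟨i, hiC, rfl⟩
    obtain ⟨σ, N, hconst, hσ, hst⟩ := LTLf.exists_holds_reduced hρ
    obtain ⟨k, v, hv, hst'⟩ := BMC.exists_encP_of_holds hconst hσ
    refine ⟨k, v, hv, ?_⟩
    rintro _ ⟨i, hi, rfl⟩
    rw [hst', hst]
    exact .inr ⟨i, hi, rfl⟩

theorem not_satisfiable_of_encC {C : Finset (Fin n)} {k : ℕ}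
    (h : ¬ (BMC.encC (input φ) k).SatUnder (assumptions V C)) :
    ¬ LTLf.Satisfiable {ψ | ∃ i ∈ C, ψ = φ i} := by
  rw [← exists_encP_satUnder_iff]
  refine fun hP => h (BMC.encC_satUnder_of_encP ?_ hP k)
  rintro _ ⟨i, -, rfl⟩
  exact ⟨_, rfl⟩

theorem exists_iter (φ : Fin n → LTLf V) (k : ℕ) : ∃ c, Iter φ (.running k) c := by
  by_cases hC : (BMC.encC (input φ) k).SatUnder (assumptions V Finset.univ)
  · by_cases hP : (BMC.encP (input φ) k).SatUnder (assumptions V Finset.univ)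
    · exact ⟨_, .sat k hC hP⟩
    · exact ⟨_, .next k hC hP⟩
  · exact ⟨_, .unsat k Finset.univ hC hC⟩

/-- An infinite run never returns, so it refutes the witness formula at every bound. At a bound
without simple paths the completeness formula then has no disjunct left to satisfy. -/
theorem not_exists_infinite_execution (φ : Fin n → LTLf V) :
    ¬ ∃ c : ℕ → Config n, c 0 = .running 0 ∧ ∀ m, Iter φ (c m) (c (m + 1)) := by
  rintro ⟨c, h0, hc⟩
  have hrun : ∀ m, c m = .running m := by
    intro m
    induction m with
    | zero => exact h0
    | succ m ih =>
      have h1 := hc m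
      have h2 := hc (m + 1)
      rw [ih] at h1
      generalize c (m + 1) = d at h1 h2
      cases h1 with
      | unsat => nomatch h2
      | sat => nomatch h2
      | next => rfl
  have hsat : ∀ m, (BMC.encC (input φ) m).SatUnder (assumptions V Finset.univ) ∧
      ¬ (BMC.encP (input φ) m).SatUnder (assumptions V Finset.univ) := by
    intro m
    have h1 := hc m
    rw [hrun, hrun] at h1
    cases h1 with
    | next _ hC hP => exact ⟨hC, hP⟩
  obtain ⟨k, hk⟩ := BMC.exists_not_simplePath (input φ)
  obtain ⟨v, hv | hv, hL⟩ := (hsat k).1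
  · exact hk v hv.2
  · obtain ⟨j, -, hj⟩ := PForm.eval_any.1 hv
    exact (hsat j).2 ⟨v, hj, hL⟩

end SatBMC

theorem mainTheorem8 {V : Type*} {n : ℕ} (φ : Fin n → LTLf V) :
    SatBMC.AlwaysReturns φ ∧
      ∀ UC : Finset (Fin n), SatBMC.Reaches φ (.returned UC) →
        (LTLf.Satisfiable (Set.range φ) → UC = ∅) ∧
        (¬ LTLf.Satisfiable (Set.range φ) →
          UC ≠ ∅ ∧ LTLf.IsUnsatCore (Set.range φ) {ψ | ∃ i ∈ UC, ψ = φ i}) := by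
  have hrange : {ψ | ∃ i ∈ (Finset.univ : Finset (Fin n)), ψ = φ i} = Set.range φ := by
    ext ψ
    simp [eq_comm]
  refine ⟨⟨SatBMC.not_exists_infinite_execution φ, fun k _ => SatBMC.exists_iter φ k⟩, ?_⟩
  intro UC hreach
  obtain h | ⟨c, -, hstep⟩ := Relation.ReflTransGen.cases_tail hreach
  · nomatch h
  cases hstep with
  | unsat k _ hC hUC =>
    have hunsat := SatBMC.not_satisfiable_of_encC hUC
    refine ⟨fun hs => absurd hs (hrange ▸ SatBMC.not_satisfiable_of_encC hC),
      fun _ => ⟨?_, ?_, hunsat⟩⟩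
    · rintro rfl
      -- An empty core would be satisfied by any trace, here one with a single state.
      exact hunsat ⟨0, fun _ => ∅, by simp⟩
    · rintro _ ⟨i, -, rfl⟩
      exact ⟨i, rfl⟩
  | sat k hC hP =>
    exact ⟨fun _ => rfl, fun hn => absurd
      (hrange ▸ SatBMC.exists_encP_satUnder_iff.1 ⟨k, hP⟩) hn⟩
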